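/- Let $M$ be a compact complex manifold of dimension $n$ with a smooth Hermitian metric $h$ and fundamental form $\omega=\sqrt{-1}\,h_{i\bar j}\,dz^i\wedge d\bar z^j$. Suppose that $(M,\omega)$ is locally conformal Kähler, i.e. there is a smooth closed real $1$-form $\theta$ on $M$ with $d\omega=\theta\wedge\omega$. Let $R_{i\bar jk\bar l}=-h_{p\bar l}\,\partial_{\bar j}\big(h^{p\bar q}\partial_i h_{k\bar q}\big)$ be the curvature tensor of the Chern connection, and suppose that the holomorphic sectional curvature is pointwise constant and nonpositive: there is a function $c:M\to(-\infty,0]$ such that, for every $p\in M$ and every nonzero $X\in T^{1,0}_pM$, $$H(X)=\frac{R(X,\bar X,X,\bar X)}{|X|^4}=c(p).$$ Then $(M,\omega)$ is globally conformal Kähler: there are a smooth function $f:M\to\mathbb R$ and a Kähler metric $\omega_0$ on $M$ (a Hermitian metric with $d\omega_0=0$) such that $\omega=e^{f}\omega_0$. -/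

import Mathlib

open scoped Manifold ContDiff ComplexConjugate

noncomputable section

namespace LCK

/-- The model space `ℂⁿ`. A complex manifold of dimension `n` is a charted space over it whose
coordinate changes are holomorphic, i.e. `IsManifold 𝓘(ℂ, Cn n) ω M`. -/
abbrev Cn (n : ℕ) : Type := EuclideanSpace ℂ (Fin n)

section Tangent

variable {n : ℕ} {M : Type*} [TopologicalSpace M] [ChartedSpace (Cn n) M]

/-- The holomorphic tangent space of `M` at `p`: a complex vector space of dimension `n`, which is
identified, as usual, with `T_p^{1,0} M` and (over `ℝ`) with the real tangent space of `M`;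
the complex structure `J` is multiplication by `i`. -/
abbrev Tan (n : ℕ) {M : Type*} [TopologicalSpace M] [ChartedSpace (Cn n) M] (p : M) : Type :=
  TangentSpace 𝓘(ℂ, Cn n) p

/-- The differential at `z` of the inverse of the chart `e`: it sends the constant vector field `u`
of `ℂⁿ` to the corresponding coordinate vector field of `M`. -/
def coordMap (e : OpenPartialHomeomorph M (Cn n)) (z : Cn n) : Cn n →L[ℂ] Tan n (e.symm z) :=
  mfderiv 𝓘(ℂ, Cn n) 𝓘(ℂ, Cn n) e.symm z

/-- The coordinate vector `∂/∂zⁱ` of the chart `e` at the point with coordinates `z`. -/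
def coordVec (e : OpenPartialHomeomorph M (Cn n)) (z : Cn n) (i : Fin n) : Tan n (e.symm z) :=
  coordMap e z (EuclideanSpace.single i 1)

end Tangent

/-- A smooth Hermitian metric on the complex manifold `M`: a positive definite Hermitian form
`h_p(X, Ȳ)` on every `T_p^{1,0} M` (complex linear in the first and conjugate linear in the second
argument), whose components `h_{i j̄}` are smooth functions in every holomorphic chart. -/
structure HermitianMetric (n : ℕ) (M : Type*) [TopologicalSpace M] [ChartedSpace (Cn n) M] where
  form : ∀ p : M, Tan n p →L[ℂ] Tan n p →L⋆[ℂ] ℂ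
  conj_symm : ∀ (p : M) (X Y : Tan n p), conj (form p X Y) = form p Y X
  pos : ∀ (p : M) (X : Tan n p), X ≠ 0 → 0 < (form p X X).re
  smooth : ∀ e ∈ atlas (Cn n) M, ∀ i j : Fin n,
    ContDiffOn ℝ ∞ (fun z => form (e.symm z) (coordVec e z i) (coordVec e z j)) e.target

section Forms

variable {n : ℕ} {M : Type*} [TopologicalSpace M] [ChartedSpace (Cn n) M]

/-- The fundamental `(1,1)`-form `ω = √-1 h_{i j̄} dzⁱ ∧ dz̄ʲ` of the Hermitian metric, as a real
2-form on the chart domain: `ω(u, v) = i (h(u, v̄) - h(v, ū)) = -2 Im h(u, v̄)`. -/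
def HermitianMetric.fundForm (h : HermitianMetric n M) (e : OpenPartialHomeomorph M (Cn n))
    (z : Cn n) : Cn n [⋀^Fin 2]→L[ℝ] ℝ where
  toFun v := -2 * (h.form (e.symm z) (coordMap e z (v 0)) (coordMap e z (v 1))).im
  map_update_add' := by
    intro _ m i x y
    fin_cases i <;> simp [Function.update] <;> ring
  map_update_smul' := by
    intro _ m i c x
    have hc : coordMap e z (c • x) = (c : ℂ) • coordMap e z x :=
      (coordMap e z).map_smul_of_tower c x
    fin_cases i <;> simp [Function.update, hc, -Complex.coe_smul] <;> ring
  cont := by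
    have hb : ∀ (b : Cn n →L[ℂ] Cn n →L⋆[ℂ] ℂ) (D : Cn n →L[ℂ] Cn n),
        Continuous fun v : Fin 2 → Cn n => b (D (v 0)) (D (v 1)) := by
      intro b D
      have h0 : Continuous fun v : Fin 2 → Cn n => D (v 0) := by fun_prop
      have h1 : Continuous fun v : Fin 2 → Cn n => D (v 1) := by fun_prop
      have hsum : ∀ x y : Cn n, b x y = ∑ i, x i * b (EuclideanSpace.single i 1) y := by
        intro x y
        conv_lhs => rw [← (EuclideanSpace.basisFun (Fin n) ℂ).sum_repr x]
        simp
      rw [funext fun v : Fin 2 → Cn n => hsum (D (v 0)) (D (v 1))]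
      fun_prop
    exact continuous_const.mul (Complex.continuous_im.comp (hb (h.form (e.symm z)) (coordMap e z)))
  map_eq_zero_of_eq' := by
    intro v i j hv hij
    have h01 : v 0 = v 1 := by
      fin_cases i <;> fin_cases j <;> simp_all
    have := h.conj_symm (e.symm z) (coordMap e z (v 1)) (coordMap e z (v 1))
    rw [h01, Complex.conj_eq_iff_im.mp this, mul_zero]

/-- A real 1-form on `M`. -/
abbrev OneForm (n : ℕ) (M : Type*) [TopologicalSpace M] [ChartedSpace (Cn n) M] :=
  ∀ p : M, Tan n p →L[ℝ] ℝ

/-- The real 1-form `θ` on the domain of the chart `e`. -/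
def OneForm.inChart (θ : OneForm n M) (e : OpenPartialHomeomorph M (Cn n)) (z : Cn n) :
    Cn n →L[ℝ] ℝ :=
  (θ (e.symm z)).comp ((coordMap e z).restrictScalars ℝ)

def OneForm.IsSmooth (θ : OneForm n M) : Prop :=
  ∀ e ∈ atlas (Cn n) M, ContDiffOn ℝ ∞ (θ.inChart e) e.target

/-- `dθ = 0`. -/
def OneForm.IsClosed (θ : OneForm n M) : Prop :=
  ∀ e ∈ atlas (Cn n) M, ∀ z ∈ e.target,
    extDeriv (fun w => ContinuousAlternatingMap.ofSubsingleton ℝ (Cn n) ℝ (0 : Fin 1)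
      (θ.inChart e w)) z = 0

/-- `dω = 0`. -/
def HermitianMetric.IsKahler (h : HermitianMetric n M) : Prop :=
  ∀ e ∈ atlas (Cn n) M, ∀ z ∈ e.target, extDeriv (h.fundForm e) z = 0

/-- `dω = θ ∧ ω` for some smooth closed real 1-form `θ` (the Lee form). -/
def HermitianMetric.IsLocallyConformalKahler (h : HermitianMetric n M) : Prop :=
  ∃ θ : OneForm n M, θ.IsSmooth ∧ θ.IsClosed ∧
    ∀ e ∈ atlas (Cn n) M, ∀ z ∈ e.target, ∀ u v w : Cn n,
      extDeriv (h.fundForm e) z ![u, v, w] =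
        θ.inChart e z u * h.fundForm e z ![v, w] - θ.inChart e z v * h.fundForm e z ![u, w]
          + θ.inChart e z w * h.fundForm e z ![u, v]

/-- `h = e^f h₀` for a Kähler metric `h₀` and a smooth real function `f` on the whole of `M`. -/
def HermitianMetric.IsGloballyConformalKahler (h : HermitianMetric n M) : Prop :=
  ∃ (f : M → ℝ) (h₀ : HermitianMetric n M), ContMDiff 𝓘(ℝ, Cn n) 𝓘(ℝ, ℝ) ∞ f ∧ h₀.IsKahler ∧
    ∀ (p : M) (X Y : Tan n p), h.form p X Y = (Real.exp (f p) : ℂ) * h₀.form p X Y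

end Forms

section Curvature

/-- `∂F/∂zⁱ = (∂F/∂xⁱ - √-1 ∂F/∂yⁱ)/2`. -/
def dz {n : ℕ} (i : Fin n) (F : Cn n → ℂ) (z : Cn n) : ℂ :=
  (fderiv ℝ F z (EuclideanSpace.single i 1)
    - Complex.I * fderiv ℝ F z (EuclideanSpace.single i Complex.I)) / 2

/-- `∂F/∂z̄ⁱ = (∂F/∂xⁱ + √-1 ∂F/∂yⁱ)/2`. -/
def dzbar {n : ℕ} (i : Fin n) (F : Cn n → ℂ) (z : Cn n) : ℂ :=
  (fderiv ℝ F z (EuclideanSpace.single i 1)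
    + Complex.I * fderiv ℝ F z (EuclideanSpace.single i Complex.I)) / 2

variable {n : ℕ} {M : Type*} [TopologicalSpace M] [ChartedSpace (Cn n) M]

/-- The matrix of components `h_{i j̄} = h(∂/∂zⁱ, ∂/∂z̄ʲ)` in the chart `e`. -/
def HermitianMetric.comp (h : HermitianMetric n M) (e : OpenPartialHomeomorph M (Cn n))
    (z : Cn n) : Matrix (Fin n) (Fin n) ℂ :=
  Matrix.of fun i j => h.form (e.symm z) (coordVec e z i) (coordVec e z j)

/-- The Christoffel symbols `Γ_{ij}^k = h^{k l̄} ∂_i h_{j l̄}` of the Chern connection, where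
`h^{k l̄}` is the transposed inverse of `h_{k l̄}`. -/
def HermitianMetric.christoffel (h : HermitianMetric n M) (e : OpenPartialHomeomorph M (Cn n))
    (i j k : Fin n) (z : Cn n) : ℂ :=
  ∑ l, (h.comp e z)⁻¹ l k * dz i (fun w => h.comp e w j l) z

/-- The components `R_{i j̄ k l̄} = - h_{p l̄} ∂_{j̄} Γ_{ik}^p` of the curvature tensor of the Chern
connection. -/
def HermitianMetric.chernCurv (h : HermitianMetric n M) (e : OpenPartialHomeomorph M (Cn n))
    (z : Cn n) (i j k l : Fin n) : ℂ :=
  -∑ p, h.comp e z p l * dzbar j (h.christoffel e i k p) z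

/-- The holomorphic sectional curvature `R(X, X̄, X, X̄) / |X|⁴` of the tangent vector
`X = Xⁱ ∂/∂zⁱ` at the point with coordinates `z` in the chart `e`. -/
def HermitianMetric.holSecCurv (h : HermitianMetric n M) (e : OpenPartialHomeomorph M (Cn n))
    (z : Cn n) (X : Cn n) : ℂ :=
  (∑ i, ∑ j, ∑ k, ∑ l, h.chernCurv e z i j k l * X i * conj (X j) * X k * conj (X l)) /
    (∑ i, ∑ j, h.comp e z i j * X i * conj (X j)) ^ 2

/-- At every point `p` of `M`, the holomorphic sectional curvature of every nonzero
`X ∈ T_p^{1,0} M` equals `c p`. -/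
def HermitianMetric.HasPointwiseConstHolSecCurv (h : HermitianMetric n M) (c : M → ℝ) : Prop :=
  ∀ e ∈ atlas (Cn n) M, ∀ z ∈ e.target, ∀ X : Cn n, X ≠ 0 →
    h.holSecCurv e z X = (c (e.symm z) : ℂ)

end Curvature

end LCK

end

noncomputable section

/-! Locally `θ = df`, and `e^{-f} ω` is Kähler with curvature `e^{-f} (R_{i j̄ k l̄} + θ_{i,j̄} h_{k
l̄})`, where `θ_{i,j̄} = ∂_{j̄} θ_i`. The bracket therefore has the Kähler symmetries in `(i, k)`
and in `(j, l)` (`LeeData.curv_add_symm_left`, `LeeData.curv_add_symm_right`). By polarization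
(`eq_zero_of_quartic_diag`) it is determined by its values `c |X|⁴ + θ_{i,j̄} Xⁱ X̄ʲ |X|²` on the
diagonal, which gives the explicit formula `LeeData.curv_add_eq`.

Tracing that formula over `k, l̄` (`LeeData.trace_curv`) gives `∂_{j̄} s_i = λ h_{i j̄}` with `s_i =
(3n-2)/4 θ_i - Γ_{ik}^k` and `λ = h^{i j̄} θ_{i,j̄} / 4 + (n+1) c / 2`. The `(1,0)`-form `s` is
`∂`-closed, because `θ` is closed and `Γ_{ik}^k = ∂_i log det h`. Hence `λ ω` is closed, and for `n
≥ 2` the equation `dω = θ ∧ ω` yields `dλ = -λ θ` (`LeeData.dz_factor`, `fderiv_einsteinFactor`).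

This is a linear first-order equation, so the zero set `Z` of `λ` is open and closed
(`isClopen_zeros`); `M` need not be connected. Off `Z`, `θ = -d log |λ|`. On `Z`, `c ≤ 0` forces
`h^{i j̄} θ_{i,j̄} = -2(n+1) c ≥ 0`. The divergence of the vector field dual to `θ` is, in complex
form, `h^{i j̄} θ_{i,j̄} + (n-1) |θ|²`, and it integrates to zero over `Z`
(`lee_divergence_eq_zero`); so `θ = 0` on `Z`. Thus `f = -log |λ|` off `Z` and `f = 0` on `Z` is a
smooth primitive of `θ`, and `e^{-f} ω` is Kähler. For `n ≤ 1` there are no nonzero 3-forms. -/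

namespace LCK

open Topology MeasureTheory ComplexOrder

/-! ### Calculus of the Wirtinger derivatives. -/

section Wirtinger

variable {n : ℕ} {U : Set (Cn n)} {F G : Cn n → ℂ} {z : Cn n} {ι : Type*}

/-- The common form of `∂/∂zⁱ` (for `a = -√-1`) and `∂/∂z̄ⁱ` (for `a = √-1`). -/
def wirt (a : ℂ) (i : Fin n) (F : Cn n → ℂ) (z : Cn n) : ℂ :=
  (fderiv ℝ F z (EuclideanSpace.single i 1)
    + a * fderiv ℝ F z (EuclideanSpace.single i Complex.I)) / 2

lemma dz_eq_wirt (i : Fin n) : dz i = wirt (n := n) (-Complex.I) i := by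
  funext F z
  simp [dz, wirt, sub_eq_add_neg]

lemma wirt_congr {a : ℂ} {i : Fin n} (h : F =ᶠ[𝓝 z] G) : wirt a i F z = wirt a i G z := by
  simp [wirt, h.fderiv_eq]

lemma wirt_const {a : ℂ} {i : Fin n} (c : ℂ) : wirt a i (fun _ : Cn n => c) z = 0 := by
  simp [wirt]

lemma wirt_mul {a : ℂ} {i : Fin n} (hF : DifferentiableAt ℝ F z) (hG : DifferentiableAt ℝ G z) :
    wirt a i (fun w => F w * G w) z = F z * wirt a i G z + wirt a i F z * G z := by
  simp only [wirt]
  rw [fderiv_fun_mul hF hG]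
  simp
  ring

lemma wirt_sub {a : ℂ} {i : Fin n} (hF : DifferentiableAt ℝ F z) (hG : DifferentiableAt ℝ G z) :
    wirt a i (fun w => F w - G w) z = wirt a i F z - wirt a i G z := by
  simp only [wirt]
  rw [fderiv_fun_sub hF hG]
  simp
  ring

lemma wirt_const_mul {a : ℂ} {i : Fin n} (c : ℂ) (hF : DifferentiableAt ℝ F z) :
    wirt a i (fun w => c * F w) z = c * wirt a i F z := by
  rw [wirt_mul (by fun_prop) hF, wirt_const]
  ring

lemma wirt_sum {a : ℂ} {i : Fin n} {s : Finset ι} {F : ι → Cn n → ℂ}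
    (hF : ∀ k ∈ s, DifferentiableAt ℝ (F k) z) :
    wirt a i (fun w => ∑ k ∈ s, F k w) z = ∑ k ∈ s, wirt a i (F k) z := by
  simp only [wirt]
  rw [fderiv_fun_sum hF]
  simp only [sum_apply, Finset.mul_sum, ← Finset.sum_add_distrib,
    Finset.sum_div]

lemma wirt_sum_mul {a : ℂ} {i : Fin n} {s : Finset ι} {F G : ι → Cn n → ℂ}
    (hF : ∀ k ∈ s, DifferentiableAt ℝ (F k) z) (hG : ∀ k ∈ s, DifferentiableAt ℝ (G k) z) :
    wirt a i (fun w => ∑ k ∈ s, F k w * G k w) z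
      = ∑ k ∈ s, (F k z * wirt a i (G k) z + wirt a i (F k) z * G k z) := by
  rw [wirt_sum (F := fun k w => F k w * G k w) fun k hk => (hF k hk).mul (hG k hk)]
  exact Finset.sum_congr rfl fun k hk => wirt_mul (hF k hk) (hG k hk)

lemma wirt_conj {a : ℂ} {i : Fin n} :
    wirt a i (fun w => conj (F w)) z = conj (wirt (conj a) i F z) := by
  have : fderiv ℝ (fun w => conj (F w)) z
      = (Complex.conjCLE : ℂ →L[ℝ] ℂ).comp (fderiv ℝ F z) :=
    Complex.conjCLE.comp_fderiv (f := F)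
  simp [wirt, this, Complex.conj_ofNat]

lemma contDiffOn_wirt {a : ℂ} {i : Fin n} (hU : IsOpen U) (hF : ContDiffOn ℝ ∞ F U) :
    ContDiffOn ℝ ∞ (wirt a i F) U := by
  have h : ContDiffOn ℝ ∞ (fun z => fderiv ℝ F z) U := hF.fderiv_of_isOpen hU (by simp)
  unfold wirt
  have h1 := h.clm_apply (contDiffOn_const (c := (EuclideanSpace.single i 1 : Cn n)))
  have h2 := h.clm_apply (contDiffOn_const (c := (EuclideanSpace.single i Complex.I : Cn n)))
  exact (h1.add (contDiffOn_const.mul h2)).div_const 2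

lemma fderiv_wirt {a : ℂ} {i : Fin n} (hU : IsOpen U) (hF : ContDiffOn ℝ ∞ F U) (hz : z ∈ U)
    (v : Cn n) : fderiv ℝ (wirt a i F) z v
      = (fderiv ℝ (fderiv ℝ F) z v (EuclideanSpace.single i 1)
        + a * fderiv ℝ (fderiv ℝ F) z v (EuclideanSpace.single i Complex.I)) / 2 := by
  have h : ContDiffOn ℝ ∞ (fun z => fderiv ℝ F z) U := hF.fderiv_of_isOpen hU (by simp)
  have hd : DifferentiableAt ℝ (fderiv ℝ F) z :=
    (h.differentiableOn (by simp)).differentiableAt (hU.mem_nhds hz)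
  have h1 : ∀ u : Cn n, HasFDerivAt (fun z => fderiv ℝ F z u)
      ((fderiv ℝ (fderiv ℝ F) z).flip u) z := fun u => by
    simpa using hd.hasFDerivAt.clm_apply (hasFDerivAt_const u z)
  have h2 := ((h1 (EuclideanSpace.single i 1)).add
    ((h1 (EuclideanSpace.single i Complex.I)).const_mul a)).mul_const (2⁻¹ : ℂ)
  have h3 : wirt a i F = fun z => (fderiv ℝ F z (EuclideanSpace.single i 1)
    + a * fderiv ℝ F z (EuclideanSpace.single i Complex.I)) * 2⁻¹ := by
    funext z; simp [wirt, div_eq_mul_inv]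
  rw [h3]
  refine (congrArg (fun L => L v) h2.fderiv).trans ?_
  simp [div_eq_mul_inv]
  ring

/-- Both operators are constant complex combinations of real directional derivatives, so this is the
symmetry of the second real derivative, for arbitrary `a` and `b`. -/
lemma wirt_comm {a b : ℂ} {i j : Fin n} (hU : IsOpen U) (hF : ContDiffOn ℝ ∞ F U) (hz : z ∈ U) :
    wirt a i (wirt b j F) z = wirt b j (wirt a i F) z := by
  have hs : IsSymmSndFDerivAt ℝ F z :=
    (hF.contDiffAt (hU.mem_nhds hz)).isSymmSndFDerivAt (by simpa using (mod_cast le_top : ((2 : ℕ∞) : WithTop ℕ∞) ≤ ∞))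
  rw [wirt, wirt, fderiv_wirt hU hF hz, fderiv_wirt hU hF hz, fderiv_wirt hU hF hz,
    fderiv_wirt hU hF hz]
  rw [hs.eq (EuclideanSpace.single i 1) (EuclideanSpace.single j 1),
    hs.eq (EuclideanSpace.single i 1) (EuclideanSpace.single j Complex.I),
    hs.eq (EuclideanSpace.single i Complex.I) (EuclideanSpace.single j 1),
    hs.eq (EuclideanSpace.single i Complex.I) (EuclideanSpace.single j Complex.I)]
  ring

lemma single_eq_smul (i : Fin n) (c : ℂ) :
    (EuclideanSpace.single i c : Cn n) = c • EuclideanSpace.single i 1 := by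
  ext k
  by_cases h : k = i <;> simp [h]

lemma sum_single_eq (v : Cn n) : v = ∑ i, v i • (EuclideanSpace.single i 1 : Cn n) := by
  conv_lhs => rw [← (EuclideanSpace.basisFun (Fin n) ℂ).sum_repr v]
  simp

/-- A real linear map on `ℂⁿ` in terms of its values on the real coordinate vectors. -/
lemma real_linear_apply {V : Type*} [AddCommGroup V] [Module ℝ V] (L : Cn n →ₗ[ℝ] V) (v : Cn n) :
    L v = ∑ i, ((v i).re • L (EuclideanSpace.single i 1)
      + (v i).im • L (EuclideanSpace.single i Complex.I)) := by
  conv_lhs => rw [sum_single_eq v]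
  rw [map_sum]
  refine Finset.sum_congr rfl fun i _ => ?_
  rw [← map_smul, ← map_smul, ← map_add]
  congr 1
  rw [single_eq_smul i Complex.I]
  conv_lhs => rw [← Complex.re_add_im (v i), add_smul, mul_smul]
  rfl

lemma fderiv_apply_eq_wirt (v : Cn n) : fderiv ℝ F z v
      = ∑ i, (wirt (-Complex.I) i F z * v i + wirt Complex.I i F z * conj (v i)) := by
  refine (real_linear_apply (fderiv ℝ F z).toLinearMap v).trans ?_
  refine Finset.sum_congr rfl fun i _ => ?_
  simp only [wirt, ContinuousLinearMap.coe_coe, Complex.real_smul]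
  set a := fderiv ℝ F z (EuclideanSpace.single i 1)
  set b := fderiv ℝ F z (EuclideanSpace.single i Complex.I)
  have h1 : conj (v i) = (v i).re - (v i).im * Complex.I := by
    apply Complex.ext <;> simp
  rw [h1]
  linear_combination ((a - Complex.I * b) / 2) * Complex.re_add_im (v i)
    + (b * (v i).im) * Complex.I_mul_I

end Wirtinger

local notation "∂z" => wirt (-Complex.I)
local notation "∂zb" => wirt Complex.I

/-! ### Derivatives of the inverse and of the determinant of a matrix of functions. -/

section InverseMetric

variable {n : ℕ}

/-- The entries of the inverse matrix of `(H i j)`. -/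
def invComp (H : Fin n → Fin n → Cn n → ℂ) (i j : Fin n) (z : Cn n) : ℂ :=
  (Matrix.of fun i j => H i j z)⁻¹ i j

/-- The determinant of `(H i j)`. -/
def detComp (H : Fin n → Fin n → Cn n → ℂ) (z : Cn n) : ℂ :=
  (Matrix.of fun i j => H i j z).det

lemma contDiffOn_det {ι : Type*} [Fintype ι] [DecidableEq ι] {U : Set (Cn n)}
    {A : ι → ι → Cn n → ℂ} (hA : ∀ i j, ContDiffOn ℝ ∞ (A i j) U) :
    ContDiffOn ℝ ∞ (fun z => (Matrix.of fun i j => A i j z).det) U := by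
  simp only [Matrix.det_apply, Matrix.of_apply]
  refine ContDiffOn.sum fun σ _ => ?_
  exact (contDiffOn_prod fun i _ => hA _ _).const_smul (Equiv.Perm.sign σ)

/-- Cramer's rule: an entry of the inverse is `det⁻¹` times the determinant of a matrix with one row
replaced by a constant basis vector. -/
lemma contDiffOn_invComp {U : Set (Cn n)} {H : Fin n → Fin n → Cn n → ℂ}
    (hH : ∀ i j, ContDiffOn ℝ ∞ (H i j) U) (hd : ∀ z ∈ U, detComp H z ≠ 0) (i j : Fin n) :
    ContDiffOn ℝ ∞ (invComp H i j) U := by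
  have h1 : invComp H i j = fun z => (detComp H z)⁻¹
      * ((Matrix.of fun i j => H i j z).updateRow j (Pi.single i 1)).det := by
    funext z
    simp [invComp, detComp, Matrix.inv_def, Matrix.adjugate_apply]
  rw [h1]
  refine ((contDiffOn_det hH).inv hd).mul ?_
  have h2 : ∀ z, (Matrix.of fun i j => H i j z).updateRow j (Pi.single i 1)
      = Matrix.of fun k l => if k = j then (Pi.single i 1 : Fin n → ℂ) l else H k l z := by
    intro z
    ext k l
    by_cases h : k = j <;> simp [Matrix.updateRow_apply, h]
  simp only [h2]
  refine contDiffOn_det (A := fun k l z =>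
    if k = j then (Pi.single i 1 : Fin n → ℂ) l else H k l z) fun k l => ?_
  by_cases h : k = j
  · simpa [h] using contDiffOn_const
  · simpa [h] using hH k l

/-- Jacobi's formula. -/
lemma wirt_det {a : ℂ} {m : Fin n} {z : Cn n} {H : Fin n → Fin n → Cn n → ℂ}
    (hH : ∀ i j, DifferentiableAt ℝ (H i j) z) (hd : detComp H z ≠ 0) :
    wirt a m (detComp H) z
      = detComp H z * ∑ k, ∑ l, invComp H l k z * wirt a m (H k l) z := by
  have key : ∀ v : Cn n, fderiv ℝ (detComp H) z v
      = ∑ k, ∑ l, detComp H z * invComp H l k z * fderiv ℝ (H k l) z v := by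
    intro v
    -- The determinant is multilinear in the rows, so its derivative is a sum of determinants with
    -- one row differentiated.
    let D : ContinuousMultilinearMap ℂ (fun _ : Fin n => Fin n → ℂ) ℂ :=
      ⟨(Matrix.detRowAlternating : (Fin n → ℂ) [⋀^Fin n]→ₗ[ℂ] ℂ).toMultilinearMap,
        Continuous.matrix_det (A := fun M : Matrix (Fin n) (Fin n) ℂ => M) continuous_id⟩
    have h1 := HasFDerivAt.multilinear_comp (D.restrictScalars ℝ) (x := z)
      (g := fun k w l => H k l w) (g' := fun k => ContinuousLinearMap.pi fun l =>
        fderiv ℝ (H k l) z) fun k => hasFDerivAt_pi.2 fun l => (hH k l).hasFDerivAt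
    have h2 : fderiv ℝ (detComp H) z v = _ := congrArg (fun L => L v) h1.fderiv
    rw [h2]
    simp only [sum_apply, ContinuousLinearMap.comp_apply]
    refine Finset.sum_congr rfl fun k _ => ?_
    -- Expansion along the replaced row `k`: the cofactors are the entries of the adjugate, that is,
    -- `det` times the inverse.
    have h3 : ∀ w : Fin n → ℂ, ((Matrix.of fun i j => H i j z).updateRow k w).det
        = ∑ l, detComp H z * invComp H l k z * w l := by
      intro w
      rw [← Matrix.cramer_transpose_apply, Matrix.cramer_eq_adjugate_mulVec,
        ← Matrix.adjugate_transpose, Matrix.mulVec, dotProduct]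
      refine Finset.sum_congr rfl fun l _ => ?_
      rw [Matrix.transpose_apply, invComp, Matrix.inv_def, Matrix.smul_apply, smul_eq_mul,
        Ring.inverse_eq_inv', ← mul_assoc]
      change _ = detComp H z * (detComp H z)⁻¹ * _ * _
      rw [mul_inv_cancel₀ hd, one_mul]
    exact h3 fun l => fderiv ℝ (H k l) z v
  simp only [wirt, key, Finset.mul_sum, ← Finset.sum_add_distrib, Finset.sum_div]
  refine Finset.sum_congr rfl fun k _ => Finset.sum_congr rfl fun l _ => ?_
  ring

end InverseMetric

/-! ### Local tensor calculus: Christoffel symbols, torsion and curvature. -/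

/-- The components `H i j = h_{i j̄}` and `t i = θ_i` of a locally conformal Kähler metric and of
its Lee form on an open set of `ℂⁿ`. -/
structure LeeData {n : ℕ} (U : Set (Cn n)) (H : Fin n → Fin n → Cn n → ℂ) (t : Fin n → Cn n → ℂ) :
    Prop where
  isOpen : IsOpen U
  smooth : ∀ i j, ContDiffOn ℝ ∞ (H i j) U
  smooth_lee : ∀ i, ContDiffOn ℝ ∞ (t i) U
  conj_symm : ∀ z i j, conj (H i j z) = H j i z
  pos : ∀ z ∈ U, ∀ X : Fin n → ℂ, X ≠ 0 → 0 < (∑ i, ∑ j, H i j z * X i * conj (X j)).re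
  -- This is the `(2,1)` part of `dω = θ ∧ ω`; the `(1,2)` part is its conjugate.
  torsion : ∀ z ∈ U, ∀ m i j, ∂z m (H i j) z - ∂z i (H m j) z = t m z * H i j z - t i z * H m j z
  -- The last two fields are the `(2,0)` and `(1,1)` parts of `dθ = 0`, where the reality of `θ`
  -- gives `θ_{j̄} = conj θ_j`.
  dz_lee : ∀ z ∈ U, ∀ i j, ∂z i (t j) z = ∂z j (t i) z
  dzbar_lee : ∀ z ∈ U, ∀ i j, conj (∂zb j (t i) z) = ∂zb i (t j) z

/-- The Christoffel symbols `Γ_{ik}^p` of the components `H`. -/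
def chris {n : ℕ} (H : Fin n → Fin n → Cn n → ℂ) (i k p : Fin n) (z : Cn n) : ℂ :=
  ∑ l, invComp H l p z * ∂z i (H k l) z

/-- The Chern curvature of the components `H`. -/
def curv {n : ℕ} (H : Fin n → Fin n → Cn n → ℂ) (i j k l : Fin n) (z : Cn n) : ℂ :=
  -∑ p, H p l z * ∂zb j (chris H i k p) z

/-- The trace `h^{k l̄} T_{k l̄}`. -/
def trComp {n : ℕ} (H : Fin n → Fin n → Cn n → ℂ) (T : Fin n → Fin n → ℂ) (z : Cn n) : ℂ :=
  ∑ k, ∑ l, invComp H l k z * T k l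

namespace LeeData

variable {n : ℕ} {U : Set (Cn n)} {H : Fin n → Fin n → Cn n → ℂ} {t : Fin n → Cn n → ℂ} {z : Cn n}

lemma posDef (L : LeeData U H t) (hz : z ∈ U) : (Matrix.of fun i j => H i j z).PosDef := by
  refine Matrix.PosDef.of_dotProduct_mulVec_pos ?_ fun x hx => ?_
  · ext i j
    simp [L.conj_symm]
  -- `Matrix.PosDef` conjugates the vector paired with the first index and the Hermitian form the
  -- one paired with the second, so positivity is used at `conj x`.
  · have hX : (fun i => conj (x i)) ≠ 0 := by
      contrapose! hx
      ext i
      simpa using congrFun hx i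
    have h1 := L.pos z hz _ hX
    have h2 : star x ⬝ᵥ (Matrix.of fun i j => H i j z).mulVec x
        = ∑ i, ∑ j, H i j z * conj (x i) * conj (conj (x j)) := by
      simp only [dotProduct, Matrix.mulVec, Finset.mul_sum, Pi.star_apply, Matrix.of_apply,
        Complex.conj_conj]
      refine Finset.sum_congr rfl fun i _ => Finset.sum_congr rfl fun j _ => ?_
      simp only [RCLike.star_def]
      ring
    have h3 : conj (∑ i, ∑ j, H i j z * conj (x i) * conj (conj (x j)))
        = ∑ i, ∑ j, H i j z * conj (x i) * conj (conj (x j)) := by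
      simp only [map_sum, map_mul, L.conj_symm, Complex.conj_conj]
      rw [Finset.sum_comm]
      refine Finset.sum_congr rfl fun i _ => Finset.sum_congr rfl fun j _ => ?_
      ring
    rw [h2, Complex.lt_def]
    exact ⟨h1, (Complex.conj_eq_iff_im.1 h3).symm⟩

lemma det_pos (L : LeeData U H t) (hz : z ∈ U) : 0 < detComp H z :=
  (L.posDef hz).det_pos

lemma det_ne (L : LeeData U H t) (hz : z ∈ U) : detComp H z ≠ 0 := (L.det_pos hz).ne'

lemma smooth_inv (L : LeeData U H t) (i j : Fin n) : ContDiffOn ℝ ∞ (invComp H i j) U :=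
  contDiffOn_invComp L.smooth (fun _ hz => L.det_ne hz) i j

lemma sum_inv_mul (L : LeeData U H t) (hz : z ∈ U) (k p : Fin n) :
    ∑ l, invComp H k l z * H l p z = if k = p then 1 else 0 := by
  have := congrFun₂ (Matrix.nonsing_inv_mul _ (L.det_ne hz).isUnit) k p
  rw [Matrix.mul_apply, Matrix.one_apply] at this
  exact this

lemma sum_mul_inv (L : LeeData U H t) (hz : z ∈ U) (k p : Fin n) :
    ∑ l, H k l z * invComp H l p z = if k = p then 1 else 0 := by
  have := congrFun₂ (Matrix.mul_nonsing_inv _ (L.det_ne hz).isUnit) k p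
  rw [Matrix.mul_apply, Matrix.one_apply] at this
  exact this

lemma conj_inv (L : LeeData U H t) (i j : Fin n) (z : Cn n) :
    conj (invComp H i j z) = invComp H j i z := by
  have h1 : (Matrix.of fun i j => H i j z).IsHermitian := by
    ext i j
    simp [L.conj_symm]
  exact congrFun₂ h1.inv j i

/-- Contraction of a sum against `h^{k l̄} h_{j l̄}`. -/
lemma sum_sum_inv_mul_right (L : LeeData U H t) (hz : z ∈ U) (a : Fin n → ℂ) (j : Fin n) :
    ∑ k, ∑ l, invComp H l k z * (a k * H j l z) = a j := by
  have : ∀ k, ∑ l, invComp H l k z * (a k * H j l z) = a k * (if j = k then 1 else 0) := by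
    intro k
    rw [← L.sum_mul_inv hz, Finset.mul_sum]
    exact Finset.sum_congr rfl fun l _ => by ring
  simp [this]

/-- Contraction of a sum against `h^{k l̄} h_{k j̄}`. -/
lemma sum_sum_inv_mul_left (L : LeeData U H t) (hz : z ∈ U) (a : Fin n → ℂ) (j : Fin n) :
    ∑ k, ∑ l, invComp H l k z * (a l * H k j z) = a j := by
  rw [Finset.sum_comm]
  have : ∀ l, ∑ k, invComp H l k z * (a l * H k j z) = a l * (if l = j then 1 else 0) := by
    intro l
    rw [← L.sum_inv_mul hz, Finset.mul_sum]
    exact Finset.sum_congr rfl fun k _ => by ring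
  simp [this]

lemma trace_metric (L : LeeData U H t) (hz : z ∈ U) :
    ∑ k, ∑ l, invComp H l k z * H k l z = n := by
  rw [Finset.sum_comm]
  simp [L.sum_inv_mul hz]

section Smooth

lemma diff (L : LeeData U H t) (hz : z ∈ U) (i j) : DifferentiableAt ℝ (H i j) z :=
  ((L.smooth i j).differentiableOn (by simp)).differentiableAt (L.isOpen.mem_nhds hz)

lemma diff_lee (L : LeeData U H t) (hz : z ∈ U) (i) : DifferentiableAt ℝ (t i) z :=
  ((L.smooth_lee i).differentiableOn (by simp)).differentiableAt (L.isOpen.mem_nhds hz)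

lemma diff_inv (L : LeeData U H t) (hz : z ∈ U) (i j) : DifferentiableAt ℝ (invComp H i j) z :=
  ((L.smooth_inv i j).differentiableOn (by simp)).differentiableAt (L.isOpen.mem_nhds hz)

lemma smooth_chris (L : LeeData U H t) (i k p : Fin n) : ContDiffOn ℝ ∞ (chris H i k p) U := by
  unfold chris
  exact ContDiffOn.sum fun l _ => (L.smooth_inv l p).mul (contDiffOn_wirt L.isOpen (L.smooth k l))

lemma diff_chris (L : LeeData U H t) (hz : z ∈ U) (i k p : Fin n) :
    DifferentiableAt ℝ (chris H i k p) z :=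
  ((L.smooth_chris i k p).differentiableOn (by simp)).differentiableAt (L.isOpen.mem_nhds hz)

end Smooth

/-- Functions which agree on `U` have the same derivatives there. -/
lemma wirt_eq (L : LeeData U H t) (hz : z ∈ U) {F G : Cn n → ℂ} (h : ∀ w ∈ U, F w = G w) (a : ℂ)
    (i : Fin n) : wirt a i F z = wirt a i G z :=
  wirt_congr (Filter.eventuallyEq_of_mem (L.isOpen.mem_nhds hz) h)

lemma sum_chris_mul (L : LeeData U H t) (hz : z ∈ U) (i k l : Fin n) :
    ∑ p, chris H i k p z * H p l z = ∂z i (H k l) z := by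
  rw [← L.sum_sum_inv_mul_left hz (fun l => ∂z i (H k l) z) l]
  simp only [chris, Finset.sum_mul]
  refine Finset.sum_congr rfl fun p _ => Finset.sum_congr rfl fun q _ => ?_
  ring

/-- Applying `∂_{j̄}` to `Γ_{ik}^p h_{p l̄} = ∂_i h_{k l̄}` gives the curvature without derivatives
of the inverse metric. -/
lemma curv_eq (L : LeeData U H t) (hz : z ∈ U) (i j k l : Fin n) :
    curv H i j k l z = -∂zb j (∂z i (H k l)) z + ∑ p, chris H i k p z * ∂zb j (H p l) z := by
  rw [← L.wirt_eq hz (fun w hw => L.sum_chris_mul hw i k l) Complex.I j,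
    wirt_sum_mul (F := fun p => chris H i k p) (G := fun p => H p l)
      (fun p _ => L.diff_chris hz i k p) (fun p _ => L.diff hz p l), Finset.sum_add_distrib, curv]
  have : ∑ p, H p l z * ∂zb j (chris H i k p) z = ∑ p, ∂zb j (chris H i k p) z * H p l z :=
    Finset.sum_congr rfl fun p _ => mul_comm _ _
  rw [this]
  ring

lemma conj_dz (L : LeeData U H t) (m i j : Fin n) (z : Cn n) :
    conj (∂z m (H i j) z) = ∂zb m (H j i) z := by
  have h : H j i = fun w => conj (H i j w) := funext fun w => (L.conj_symm w i j).symm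
  rw [h, wirt_conj]
  simp

lemma conj_dzbar (L : LeeData U H t) (m i j : Fin n) (z : Cn n) :
    conj (∂zb m (H i j) z) = ∂z m (H j i) z := by
  rw [← L.conj_dz, Complex.conj_conj]

/-- Both terms of `curv_eq` are Hermitian: in the first the derivatives `∂` and `∂̄` commute, in the
second conjugation exchanges the two factors `∂h` and `∂̄h` around the Hermitian inverse. -/
lemma conj_curv (L : LeeData U H t) (hz : z ∈ U) (i j k l : Fin n) :
    conj (curv H i j k l z) = curv H j i l k z := by
  rw [L.curv_eq hz, L.curv_eq hz, map_add, map_neg]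
  congr 1
  · have h : ∂zb i (∂z j (H l k)) z = ∂z j (∂zb i (H l k)) z :=
      wirt_comm L.isOpen (L.smooth l k) hz
    have h2 : ∂zb i (H l k) = fun w => conj (∂z i (H k l) w) :=
      funext fun w => (L.conj_dz i k l w).symm
    rw [h, h2, wirt_conj]
    simp
  · simp only [chris, Finset.sum_mul, map_sum, map_mul, L.conj_inv, L.conj_dz, L.conj_dzbar]
    rw [Finset.sum_comm]
    refine Finset.sum_congr rfl fun p _ => Finset.sum_congr rfl fun q _ => ?_
    ring

/-- The torsion of the Chern connection. -/
lemma chris_sub (L : LeeData U H t) (hz : z ∈ U) (i k p : Fin n) :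
    chris H i k p z - chris H k i p z
      = t i z * (if k = p then 1 else 0) - t k z * (if i = p then 1 else 0) := by
  rw [← L.sum_mul_inv hz, ← L.sum_mul_inv hz, Finset.mul_sum, Finset.mul_sum, chris, chris,
    ← Finset.sum_sub_distrib, ← Finset.sum_sub_distrib]
  refine Finset.sum_congr rfl fun l _ => ?_
  linear_combination invComp H l p z * L.torsion z hz i k l

/-- The curvature `R_{i j̄ k l̄} + θ_{i, j̄} h_{k l̄}` of the local Kähler metrics, up to the conformal
factor, is symmetric in `i` and `k`. -/
lemma curv_add_symm_left (L : LeeData U H t) (hz : z ∈ U) (i j k l : Fin n) :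
    curv H i j k l z + ∂zb j (t i) z * H k l z = curv H k j i l z + ∂zb j (t k) z * H i l z := by
  -- This is `∂_{j̄}` of the torsion identity; lowering the index `p` with `h_{p l̄}` turns it into
  -- a statement on the curvature.
  have key : ∀ p, ∂zb j (chris H i k p) z - ∂zb j (chris H k i p) z
      = ∂zb j (t i) z * (if k = p then 1 else 0) - ∂zb j (t k) z * (if i = p then 1 else 0) := by
    intro p
    have h := L.wirt_eq hz (fun w hw => L.chris_sub hw i k p) Complex.I j
    rw [wirt_sub (L.diff_chris hz i k p) (L.diff_chris hz k i p),
      wirt_sub ((L.diff_lee hz i).mul_const _) ((L.diff_lee hz k).mul_const _)] at h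
    rw [h, wirt_mul (L.diff_lee hz i) (by fun_prop), wirt_mul (L.diff_lee hz k) (by fun_prop),
      wirt_const, wirt_const]
    ring
  have h2 : ∑ p, H p l z * (∂zb j (chris H i k p) z - ∂zb j (chris H k i p) z)
      = ∂zb j (t i) z * H k l z - ∂zb j (t k) z * H i l z := by
    simp only [key, mul_sub, Finset.sum_sub_distrib]
    simp [mul_comm]
  simp only [mul_sub, Finset.sum_sub_distrib] at h2
  simp only [curv]
  linear_combination -h2

/-- The conjugate of `curv_add_symm_left`: both `R` and, since `θ` is closed and real, `θ_{i,j̄}`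
are Hermitian. -/
lemma curv_add_symm_right (L : LeeData U H t) (hz : z ∈ U) (i j k l : Fin n) :
    curv H i j k l z + ∂zb j (t i) z * H k l z = curv H i l k j z + ∂zb l (t i) z * H k j z := by
  have h := congrArg conj (L.curv_add_symm_left hz j i l k)
  simpa only [map_add, map_mul, L.conj_curv hz, L.conj_symm, L.dzbar_lee z hz] using h

end LeeData

/-! ### Polarization of curvature-like tensors. -/

section Polarization

variable {n : ℕ}

/-- The sesquilinear form in four variables with components `S i j k l`. -/
def quartic (S : Fin n → Fin n → Fin n → Fin n → ℂ) (A B C D : Fin n → ℂ) : ℂ :=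
  ∑ i, ∑ j, ∑ k, ∑ l, S i j k l * A i * conj (B j) * C k * conj (D l)

/-- A curvature-like tensor is determined by its holomorphic sectional curvatures. -/
theorem eq_zero_of_quartic_diag {S : Fin n → Fin n → Fin n → Fin n → ℂ}
    (h1 : ∀ i j k l, S i j k l = S k j i l) (h2 : ∀ i j k l, S i j k l = S i l k j)
    (h0 : ∀ X, quartic S X X X X = 0) (i j k l : Fin n) : S i j k l = 0 := by
  have add1 : ∀ A A' B C D, quartic S (A + A') B C D = quartic S A B C D + quartic S A' B C D := by
    intro A A' B C D
    simp only [quartic, ← Finset.sum_add_distrib, Pi.add_apply]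
    refine Finset.sum_congr rfl fun i _ => Finset.sum_congr rfl fun j _ =>
      Finset.sum_congr rfl fun k _ => Finset.sum_congr rfl fun l _ => ?_
    ring
  have smul1 : ∀ (c : ℂ) A B C D, quartic S (c • A) B C D = c * quartic S A B C D := by
    intro c A B C D
    simp only [quartic, Finset.mul_sum, Pi.smul_apply, smul_eq_mul]
    refine Finset.sum_congr rfl fun i _ => Finset.sum_congr rfl fun j _ =>
      Finset.sum_congr rfl fun k _ => Finset.sum_congr rfl fun l _ => ?_
    ring
  have add2 : ∀ A B B' C D, quartic S A (B + B') C D = quartic S A B C D + quartic S A B' C D := by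
    intro A B B' C D
    simp only [quartic, ← Finset.sum_add_distrib, Pi.add_apply, map_add]
    refine Finset.sum_congr rfl fun i _ => Finset.sum_congr rfl fun j _ =>
      Finset.sum_congr rfl fun k _ => Finset.sum_congr rfl fun l _ => ?_
    ring
  have smul2 : ∀ (c : ℂ) A B C D, quartic S A (c • B) C D = conj c * quartic S A B C D := by
    intro c A B C D
    simp only [quartic, Finset.mul_sum, Pi.smul_apply, smul_eq_mul, map_mul]
    refine Finset.sum_congr rfl fun i _ => Finset.sum_congr rfl fun j _ =>
      Finset.sum_congr rfl fun k _ => Finset.sum_congr rfl fun l _ => ?_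
    ring
  have symm1 : ∀ A B C D, quartic S A B C D = quartic S C B A D := by
    intro A B C D
    have e : quartic S A B C D
        = ∑ k, ∑ j, ∑ i, ∑ l, S i j k l * A i * conj (B j) * C k * conj (D l) := by
      rw [quartic, Finset.sum_comm]
      conv_rhs => rw [Finset.sum_comm]
      exact Finset.sum_congr rfl fun j _ => Finset.sum_comm
    rw [e, quartic]
    refine Finset.sum_congr rfl fun i _ => Finset.sum_congr rfl fun j _ =>
      Finset.sum_congr rfl fun k _ => Finset.sum_congr rfl fun l _ => ?_
    rw [h1 i j k l]
    ring
  have symm2 : ∀ A B C D, quartic S A B C D = quartic S A D C B := by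
    intro A B C D
    rw [quartic, quartic]
    refine Finset.sum_congr rfl fun i _ => ?_
    have e : ∀ f : Fin n → Fin n → Fin n → ℂ,
        ∑ j, ∑ k, ∑ l, f j k l = ∑ l, ∑ k, ∑ j, f j k l := by
      intro f
      rw [Finset.sum_comm]
      conv_rhs => rw [Finset.sum_comm]
      exact Finset.sum_congr rfl fun j _ => Finset.sum_comm
    rw [e]
    refine Finset.sum_congr rfl fun j _ =>
      Finset.sum_congr rfl fun k _ => Finset.sum_congr rfl fun l _ => ?_
    rw [h2 i j k l]
    ring
  have add3 : ∀ A B C C' D, quartic S A B (C + C') D = quartic S A B C D + quartic S A B C' D := by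
    intro A B C C' D
    rw [symm1, add1, symm1 C, symm1 C']
  have smul3 : ∀ (c : ℂ) A B C D, quartic S A B (c • C) D = c * quartic S A B C D := by
    intro c A B C D
    rw [symm1, smul1, symm1 C]
  have add4 : ∀ A B C D D', quartic S A B C (D + D') = quartic S A B C D + quartic S A B C D' := by
    intro A B C D D'
    rw [symm2, add2, symm2 A D, symm2 A D']
  have smul4 : ∀ (c : ℂ) A B C D, quartic S A B C (c • D) = conj c * quartic S A B C D := by
    intro c A B C D
    rw [symm2, smul2, symm2 A D]
  have step1 : ∀ A B, quartic S B A B A + quartic S A B A B = 0 := by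
    -- Put `X = A + ε B`. Adding the values for `ε = ±1` removes the terms of odd degree in `B`;
    -- subtracting those for `ε = ±√-1` leaves only the terms of weight `ε²` and `ε̄²`.
    intro A B
    have e1 := h0 (A + (1 : ℂ) • B)
    have e2 := h0 (A + (-1 : ℂ) • B)
    have e3 := h0 (A + Complex.I • B)
    have e4 := h0 (A + (-Complex.I) • B)
    simp only [add1, add2, add3, add4, smul1, smul2, smul3, smul4, map_neg, map_one,
      Complex.conj_I] at e1 e2 e3 e4
    have hI := Complex.I_sq
    have hI3 : Complex.I ^ 3 = -Complex.I := by rw [pow_succ, hI]; ring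
    have hI4 : Complex.I ^ 4 = 1 := by rw [pow_succ, hI3]; linear_combination -hI
    ring_nf at e1 e2 e3 e4
    rw [hI, hI3, hI4] at e3 e4
    linear_combination (e1 + e2 - e3 - e4) / 4
  have step2 : ∀ A B, quartic S B A B A = 0 := by
    intro A B
    have e1 := step1 A B
    -- Since `(1 + √-1)² = 2√-1` and its conjugate is `-2√-1`, this rescaling separates the two
    -- summands of `step1`.
    have e2 := step1 A ((1 + Complex.I) • B)
    simp only [smul1, smul2, smul3, smul4, map_add, map_one, Complex.conj_I] at e2
    have hI := Complex.I_sq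
    have e3 : (2 * Complex.I) * (quartic S B A B A - quartic S A B A B) = 0 := by
      linear_combination e2 - (quartic S B A B A + quartic S A B A B) * hI
    have e4 : quartic S B A B A - quartic S A B A B = 0 :=
      (mul_eq_zero.1 e3).resolve_left (by simp)
    linear_combination (e1 + e4) / 2
  have step3 : ∀ A B C, quartic S B A C A = 0 := by
    intro A B C
    -- Ordinary polarization of a symmetric bilinear expression, here in the linear slots and in
    -- `step4` in the conjugate-linear ones.
    have e := step2 A (B + C)
    simp only [add1, add3, step2, symm1 C A B] at e
    linear_combination e / 2
  have step4 : ∀ A B C D, quartic S B A C D = 0 := by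
    intro A B C D
    have e := step3 (A + D) B C
    simp only [add2, add4, step3, symm2 B D C A] at e
    linear_combination e / 2
  have e := step4 (Pi.single j 1) (Pi.single i 1) (Pi.single k 1) (Pi.single l 1)
  simpa [quartic, Pi.single_apply, apply_ite] using e

end Polarization

/-! ### The curvature identity and its trace. -/

namespace LeeData

variable {n : ℕ} {U : Set (Cn n)} {H : Fin n → Fin n → Cn n → ℂ} {t : Fin n → Cn n → ℂ} {z : Cn n}

/-- The curvature of the local Kähler metrics is determined by the constant holomorphic sectional
curvature of the given metric and the Hessian of the conformal factor. -/
lemma curv_add_eq (L : LeeData U H t) (hz : z ∈ U) {c : ℂ}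
    (hc : ∀ X : Fin n → ℂ, quartic (fun i j k l => curv H i j k l z) X X X X
      = c * (∑ i, ∑ j, H i j z * X i * conj (X j)) ^ 2) (i j k l : Fin n) :
    curv H i j k l z + ∂zb j (t i) z * H k l z =
      (∂zb j (t i) z * H k l z + ∂zb j (t k) z * H i l z + ∂zb l (t i) z * H k j z
        + ∂zb l (t k) z * H i j z) / 4
      + c / 2 * (H i j z * H k l z + H i l z * H k j z) := by
  rw [← sub_eq_zero]
  refine eq_zero_of_quartic_diag (S := fun i j k l =>
    curv H i j k l z + ∂zb j (t i) z * H k l z -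
      ((∂zb j (t i) z * H k l z + ∂zb j (t k) z * H i l z + ∂zb l (t i) z * H k j z
        + ∂zb l (t k) z * H i j z) / 4
      + c / 2 * (H i j z * H k l z + H i l z * H k j z))) ?_ ?_ ?_ i j k l
  -- The subtracted expression is itself symmetric in `(i, k)` and in `(j, l)`, so only the two
  -- symmetries of `R_{i j̄ k l̄} + θ_{i,j̄} h_{k l̄}` are needed.
  · intro i j k l
    linear_combination L.curv_add_symm_left hz i j k l
  · intro i j k l
    linear_combination L.curv_add_symm_right hz i j k l
  · intro X
    -- On the diagonal each of the four Hessian terms equals `E · B`, so their mean cancels the `θ`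
    -- term on the left, and the two metric terms give `c B²`.
    have hx := hc X
    set E : Fin n → Fin n → ℂ := fun i j => ∂zb j (t i) z * X i * conj (X j) with hE
    set B : Fin n → Fin n → ℂ := fun i j => H i j z * X i * conj (X j) with hB
    have hprod : ∀ P Q : Fin n → Fin n → ℂ, (∑ i, ∑ j, P i j) * (∑ i, ∑ j, Q i j)
        = ∑ i, ∑ j, ∑ k, ∑ l, P i j * Q k l := by
      intro P Q
      simp only [Finset.sum_mul]
      simp only [Finset.mul_sum]
    have hprod' : ∀ P Q : Fin n → Fin n → ℂ, (∑ i, ∑ j, P i j) * (∑ i, ∑ j, Q i j)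
        = ∑ i, ∑ j, ∑ k, ∑ l, P k j * Q i l := by
      intro P Q
      rw [hprod]
      rw [Finset.sum_comm]
      conv_rhs => rw [Finset.sum_comm]
      exact Finset.sum_congr rfl fun j _ => Finset.sum_comm
    have key : quartic (fun i j k l => curv H i j k l z + ∂zb j (t i) z * H k l z -
        ((∂zb j (t i) z * H k l z + ∂zb j (t k) z * H i l z + ∂zb l (t i) z * H k j z
          + ∂zb l (t k) z * H i j z) / 4
        + c / 2 * (H i j z * H k l z + H i l z * H k j z))) X X X X
        = quartic (fun i j k l => curv H i j k l z) X X X X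
          + (∑ i, ∑ j, E i j) * (∑ i, ∑ j, B i j)
          - (((∑ i, ∑ j, E i j) * (∑ i, ∑ j, B i j) + (∑ i, ∑ j, E i j) * (∑ i, ∑ j, B i j)
              + (∑ i, ∑ j, B i j) * (∑ i, ∑ j, E i j)
              + (∑ i, ∑ j, B i j) * (∑ i, ∑ j, E i j)) / 4
            + c / 2 * ((∑ i, ∑ j, B i j) * (∑ i, ∑ j, B i j)
              + (∑ i, ∑ j, B i j) * (∑ i, ∑ j, B i j))) := by
      have h3 : (∑ i, ∑ j, B i j) * (∑ i, ∑ j, E i j) = ∑ i, ∑ j, ∑ k, ∑ l, B k j * E i l :=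
        hprod' B E
      have h4 : (∑ i, ∑ j, E i j) * (∑ i, ∑ j, B i j) = ∑ i, ∑ j, ∑ k, ∑ l, E k j * B i l :=
        hprod' E B
      have h6 : (∑ i, ∑ j, B i j) * (∑ i, ∑ j, B i j) = ∑ i, ∑ j, ∑ k, ∑ l, B k j * B i l :=
        hprod' B B
      -- Equal products are expanded with different pairings of the indices, one for each term of
      -- the symmetrization, so that the sums agree term by term.
      conv_rhs =>
        enter [2, 1, 1, 1, 1, 2]
        rw [h4]
      conv_rhs =>
        enter [2, 1, 1, 1, 2]
        rw [h3]
      conv_rhs =>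
        enter [2, 2, 2, 2]
        rw [h6]
      simp only [hprod, quartic, Finset.mul_sum, Finset.sum_div, ← Finset.sum_add_distrib,
        ← Finset.sum_sub_distrib]
      refine Finset.sum_congr rfl fun i _ => Finset.sum_congr rfl fun j _ =>
        Finset.sum_congr rfl fun k _ => Finset.sum_congr rfl fun l _ => ?_
      simp only [hE, hB]
      ring
    rw [key, hx]
    ring

/-- The trace of the curvature of the local Kähler metrics. -/
lemma trace_curv (L : LeeData U H t) (hz : z ∈ U) {c : ℂ}
    (hc : ∀ X : Fin n → ℂ, quartic (fun i j k l => curv H i j k l z) X X X X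
      = c * (∑ i, ∑ j, H i j z * X i * conj (X j)) ^ 2) (i j : Fin n) :
    ∂zb j (fun w => (3 * n - 2) / 4 * t i w - ∑ k, chris H i k k w) z
      = (trComp H (fun k l => ∂zb l (t k) z) z / 4 + (n + 1) / 2 * c) * H i j z := by
  -- The trace of `R_{i j̄ k l̄} + θ_{i,j̄} h_{k l̄}` over `k, l̄` is computed twice: here from the
  -- definition of the curvature, below in `h2` from `curv_add_eq`.
  have h1 : ∑ k, ∑ l, invComp H l k z * (curv H i j k l z + ∂zb j (t i) z * H k l z)
      = n * ∂zb j (t i) z - ∑ k, ∂zb j (chris H i k k) z := by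
    have e1 : ∑ k, ∑ l, invComp H l k z * (∂zb j (t i) z * H k l z) = n * ∂zb j (t i) z := by
      rw [← L.trace_metric hz, Finset.sum_mul]
      refine Finset.sum_congr rfl fun k _ => ?_
      rw [Finset.sum_mul]
      exact Finset.sum_congr rfl fun l _ => by ring
    have e2 : ∑ k, ∑ l, invComp H l k z * curv H i j k l z = -∑ k, ∂zb j (chris H i k k) z := by
      rw [← Finset.sum_neg_distrib]
      refine Finset.sum_congr rfl fun k _ => ?_
      have : ∂zb j (chris H i k k) z
          = ∑ p, ∂zb j (chris H i k p) z * ∑ l, H p l z * invComp H l k z := by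
        simp [L.sum_mul_inv hz]
      rw [this]
      simp only [curv, Finset.mul_sum, mul_neg, Finset.sum_neg_distrib]
      rw [Finset.sum_comm, neg_inj]
      refine Finset.sum_congr rfl fun _ _ => Finset.sum_congr rfl fun _ _ => ?_
      ring
    simp only [mul_add, Finset.sum_add_distrib, e1, e2]
    ring
  simp only [L.curv_add_eq hz hc] at h1
  have e1 : ∑ k, ∑ l, invComp H l k z * (∂zb j (t i) z * H k l z) = n * ∂zb j (t i) z := by
    rw [← L.trace_metric hz, Finset.sum_mul]
    refine Finset.sum_congr rfl fun k _ => ?_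
    rw [Finset.sum_mul]
    exact Finset.sum_congr rfl fun l _ => by ring
  have e2 := L.sum_sum_inv_mul_right hz (fun k => ∂zb j (t k) z) i
  have e3 := L.sum_sum_inv_mul_left hz (fun l => ∂zb l (t i) z) j
  have e4 : ∑ k, ∑ l, invComp H l k z * (∂zb l (t k) z * H i j z)
      = trComp H (fun k l => ∂zb l (t k) z) z * H i j z := by
    simp only [trComp, Finset.sum_mul, mul_assoc]
  have e5 : ∑ k, ∑ l, invComp H l k z * (H i j z * H k l z) = n * H i j z := by
    rw [← L.trace_metric hz, Finset.sum_mul]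
    refine Finset.sum_congr rfl fun k _ => ?_
    rw [Finset.sum_mul]
    exact Finset.sum_congr rfl fun l _ => by ring
  have e6 := L.sum_sum_inv_mul_left hz (fun l => H i l z) j
  have h2 : ∑ k, ∑ l, invComp H l k z *
      ((∂zb j (t i) z * H k l z + ∂zb j (t k) z * H i l z + ∂zb l (t i) z * H k j z
        + ∂zb l (t k) z * H i j z) / 4
      + c / 2 * (H i j z * H k l z + H i l z * H k j z))
      = (n * ∂zb j (t i) z + ∂zb j (t i) z + ∂zb j (t i) z
        + trComp H (fun k l => ∂zb l (t k) z) z * H i j z) / 4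
        + c / 2 * (n * H i j z + H i j z) := by
    rw [← e4, ← e5]
    conv_rhs =>
      enter [1, 1, 1, 1, 1]
      rw [← e1]
    conv_rhs =>
      enter [1, 1, 1, 1, 2]
      rw [← e2]
    conv_rhs =>
      enter [1, 1, 1, 2]
      rw [← e3]
    conv_rhs =>
      enter [2, 2, 2]
      rw [← e6]
    simp only [Finset.mul_sum, Finset.sum_div, ← Finset.sum_add_distrib]
    refine Finset.sum_congr rfl fun _ _ => Finset.sum_congr rfl fun _ _ => ?_
    ring
  rw [h2] at h1
  -- The coefficient of `θ_{i,j̄}` is `n - (n + 2)/4 = (3n - 2)/4`.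
  rw [wirt_sub ((L.diff_lee hz i).const_mul _)
    (DifferentiableAt.fun_sum fun k _ => L.diff_chris hz i k k),
    wirt_const_mul _ (L.diff_lee hz i), wirt_sum fun k _ => L.diff_chris hz i k k]
  linear_combination -h1

end LeeData

/-! ### The equation `dλ = -λ θ` and the divergence of the Lee field in coordinates. -/

namespace LeeData

variable {n : ℕ} {U : Set (Cn n)} {H : Fin n → Fin n → Cn n → ℂ} {t : Fin n → Cn n → ℂ} {z : Cn n}

/-- Differentiate `H H⁻¹ = 1` and multiply by `H⁻¹` from the left. -/
lemma wirt_inv (L : LeeData U H t) (hz : z ∈ U) (a : ℂ) (m l k : Fin n) :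
    wirt a m (invComp H l k) z
      = -∑ p, ∑ q, invComp H l p z * wirt a m (H p q) z * invComp H q k z := by
  have h1 : ∀ p, ∑ q, (H p q z * wirt a m (invComp H q k) z
      + wirt a m (H p q) z * invComp H q k z) = 0 := by
    intro p
    rw [← wirt_sum_mul (F := fun q => H p q) (G := fun q => invComp H q k)
      (fun q _ => L.diff hz p q) (fun q _ => L.diff_inv hz q k),
      L.wirt_eq hz (fun w hw => L.sum_mul_inv hw p k), wirt_const]
  have h2 : wirt a m (invComp H l k) z
      = ∑ p, ∑ q, invComp H l p z * (H p q z * wirt a m (invComp H q k) z) := by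
    rw [Finset.sum_comm]
    simp only [← mul_assoc, ← Finset.sum_mul, L.sum_inv_mul hz]
    simp
  rw [h2, eq_neg_iff_add_eq_zero, ← Finset.sum_add_distrib]
  refine Finset.sum_eq_zero fun p _ => ?_
  rw [← mul_zero (invComp H l p z), ← h1 p, Finset.mul_sum, ← Finset.sum_add_distrib]
  exact Finset.sum_congr rfl fun q _ => by ring

/-- The trace `Γ_{ik}^k` is `∂_i log det h`, so its `∂`-derivatives are symmetric. Explicitly, the
second derivatives of `h` commute, and the quadratic term `tr (h⁻¹ ∂_m h h⁻¹ ∂_i h)` is symmetric by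
cyclicity. -/
lemma dz_trace_chris (L : LeeData U H t) (hz : z ∈ U) (m i : Fin n) :
    ∂z m (fun w => ∑ k, chris H i k k w) z = ∂z i (fun w => ∑ k, chris H m k k w) z := by
  have hd : ∀ i k l, DifferentiableAt ℝ (∂z i (H k l)) z := fun i k l =>
    ((contDiffOn_wirt L.isOpen (L.smooth k l)).differentiableOn (by simp)).differentiableAt
      (L.isOpen.mem_nhds hz)
  have key : ∀ m i, ∂z m (fun w => ∑ k, chris H i k k w) z
      = ∑ k, ∑ l, invComp H l k z * ∂z m (∂z i (H k l)) z
        - ∑ k, ∑ l, ∑ p, ∑ q,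
          invComp H l p z * ∂z m (H p q) z * invComp H q k z * ∂z i (H k l) z := by
    intro m i
    rw [wirt_sum fun k _ => L.diff_chris hz i k k, ← Finset.sum_sub_distrib]
    refine Finset.sum_congr rfl fun k _ => ?_
    unfold chris
    rw [wirt_sum_mul (F := fun l => invComp H l k) (G := fun l => ∂z i (H k l))
      (fun l _ => L.diff_inv hz l k) (fun l _ => hd i k l), ← Finset.sum_sub_distrib]
    refine Finset.sum_congr rfl fun l _ => ?_
    rw [L.wirt_inv hz, neg_mul, Finset.sum_mul, sub_eq_add_neg]
    simp only [Finset.sum_mul]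
  rw [key, key]
  congr 1
  · refine Finset.sum_congr rfl fun k _ => Finset.sum_congr rfl fun l _ => ?_
    rw [wirt_comm L.isOpen (L.smooth k l) hz]
  · have e : ∀ f : Fin n → Fin n → Fin n → Fin n → ℂ,
        ∑ k, ∑ l, ∑ p, ∑ q, f k l p q = ∑ p, ∑ q, ∑ k, ∑ l, f k l p q := by
      intro f
      have h : ∑ x : Fin n × Fin n, ∑ y : Fin n × Fin n, f x.1 x.2 y.1 y.2
          = ∑ y : Fin n × Fin n, ∑ x : Fin n × Fin n, f x.1 x.2 y.1 y.2 := Finset.sum_comm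
      simpa only [Fintype.sum_prod_type] using h
    rw [e]
    refine Finset.sum_congr rfl fun p _ => Finset.sum_congr rfl fun q _ =>
      Finset.sum_congr rfl fun k _ => Finset.sum_congr rfl fun l _ => ?_
    ring

section Einstein

variable {μ : Cn n → ℂ} {s : Fin n → Cn n → ℂ}

/-- `μ` is `1/n` times the trace of `∂_{j̄} s_i`. This supplies the smoothness of the factor, in
which `c` enters as an arbitrary function. -/
lemma contDiffOn_factor (L : LeeData U H t) (hn : 2 ≤ n) (hs : ∀ i, ContDiffOn ℝ ∞ (s i) U)
    (hμ : ∀ w ∈ U, ∀ i j, ∂zb j (s i) w = μ w * H i j w) : ContDiffOn ℝ ∞ μ U := by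
  have h1 : ContDiffOn ℝ ∞ (fun w => (n : ℂ)⁻¹ * ∑ i, ∑ j, invComp H j i w * ∂zb j (s i) w) U :=
    contDiffOn_const.mul (ContDiffOn.sum fun i _ => ContDiffOn.sum fun j _ =>
      (L.smooth_inv j i).mul (contDiffOn_wirt L.isOpen (hs i)))
  refine h1.congr fun w hw => ?_
  have h2 : ∑ i, ∑ j, invComp H j i w * ∂zb j (s i) w = μ w * n := by
    rw [← L.trace_metric hw, Finset.mul_sum]
    refine Finset.sum_congr rfl fun i _ => ?_
    rw [Finset.mul_sum]
    refine Finset.sum_congr rfl fun j _ => ?_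
    rw [hμ w hw]
    ring
  have : (n : ℂ) ≠ 0 := by
    have : n ≠ 0 := by omega
    exact_mod_cast this
  rw [h2]
  field_simp

/-- If `μ ω` is locally `√-1 ∂ ∂̄` exact, then `dμ = -μ θ`. -/
lemma dz_factor (L : LeeData U H t) (hn : 2 ≤ n) (hs : ∀ i, ContDiffOn ℝ ∞ (s i) U)
    (hμ : ∀ w ∈ U, ∀ i j, ∂zb j (s i) w = μ w * H i j w)
    (hsymm : ∀ w ∈ U, ∀ m i, ∂z m (s i) w = ∂z i (s m) w) (hz : z ∈ U) (m : Fin n) :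
    ∂z m μ z = -(μ z * t m z) := by
  have hd : DifferentiableAt ℝ μ z :=
    ((L.contDiffOn_factor hn hs hμ).differentiableOn (by simp)).differentiableAt
      (L.isOpen.mem_nhds hz)
  have h1 : ∀ m i j, ∂zb j (∂z m (s i)) z = μ z * ∂z m (H i j) z + ∂z m μ z * H i j z := by
    intro m i j
    rw [wirt_comm L.isOpen (hs i) hz, L.wirt_eq hz (fun w hw => hμ w hw i j),
      wirt_mul hd (L.diff hz i j)]
  -- With `α = ∂μ + μ θ^{1,0}`, the symmetry of `∂_m ∂_{j̄} s_i` in `m, i` and the torsion identity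
  -- give `α_m h_{i j̄} = α_i h_{m j̄}`.
  have h2 : ∀ i j, (∂z m μ z + μ z * t m z) * H i j z = (∂z i μ z + μ z * t i z) * H m j z := by
    intro i j
    have e1 := h1 m i j
    rw [L.wirt_eq hz (fun w hw => hsymm w hw m i), h1 i m j] at e1
    linear_combination -e1 - μ z * L.torsion z hz m i j
  have : Nontrivial (Fin n) := Fin.nontrivial_iff_two_le.2 hn
  -- Contracting `j` with the inverse metric at an index `i ≠ m` leaves `α_m = 0`; such an index
  -- exists because `n ≥ 2`.
  obtain ⟨i, hi⟩ := exists_ne m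
  have h3 : ∑ j, (∂z m μ z + μ z * t m z) * H i j z * invComp H j i z
      = ∑ j, (∂z i μ z + μ z * t i z) * H m j z * invComp H j i z :=
    Finset.sum_congr rfl fun j _ => by rw [h2 i j]
  simp only [mul_assoc, ← Finset.mul_sum, L.sum_mul_inv hz] at h3
  simp only [if_true, if_neg hi.symm] at h3
  linear_combination h3

end Einstein

/-- If the holomorphic sectional curvature is pointwise constant, then the function
`tr θ_{i, j̄} / 4 + (n + 1) c / 2` satisfies `dμ = -μ θ`. -/
lemma einstein_factor (L : LeeData U H t) (hn : 2 ≤ n) {c : Cn n → ℂ}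
    (hc : ∀ z ∈ U, ∀ X : Fin n → ℂ, quartic (fun i j k l => curv H i j k l z) X X X X
      = c z * (∑ i, ∑ j, H i j z * X i * conj (X j)) ^ 2) :
    ContDiffOn ℝ ∞ (fun z => trComp H (fun k l => ∂zb l (t k) z) z / 4 + (n + 1) / 2 * c z) U ∧
    ∀ z ∈ U, ∀ m,
      ∂z m (fun z => trComp H (fun k l => ∂zb l (t k) z) z / 4 + (n + 1) / 2 * c z) z
        = -((trComp H (fun k l => ∂zb l (t k) z) z / 4 + (n + 1) / 2 * c z) * t m z) := by
  have hs : ∀ i, ContDiffOn ℝ ∞ (fun w => (3 * n - 2) / 4 * t i w - ∑ k, chris H i k k w) U :=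
    fun i => (contDiffOn_const.mul (L.smooth_lee i)).sub
      (ContDiffOn.sum fun k _ => L.smooth_chris i k k)
  have hμ := fun w (hw : w ∈ U) => L.trace_curv hw (hc w hw)
  refine ⟨L.contDiffOn_factor hn hs hμ, fun z hz m => L.dz_factor hn hs hμ ?_ hz m⟩
  intro w hw m i
  have hd : ∀ i, DifferentiableAt ℝ (fun w => ∑ k, chris H i k k w) w := fun i =>
    DifferentiableAt.fun_sum fun k _ => L.diff_chris hw i k k
  rw [wirt_sub ((L.diff_lee hw i).const_mul _) (hd i),
    wirt_sub ((L.diff_lee hw m).const_mul _) (hd m), wirt_const_mul _ (L.diff_lee hw i),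
    wirt_const_mul _ (L.diff_lee hw m), L.dz_trace_chris hw, L.dz_lee w hw]

lemma conj_torsion (L : LeeData U H t) (hz : z ∈ U) (j k l : Fin n) :
    ∂zb j (H k l) z - ∂zb l (H k j) z = conj (t j z) * H k l z - conj (t l z) * H k j z := by
  have h := congrArg conj (L.torsion z hz j l k)
  simpa only [map_sub, map_mul, L.conj_dz, L.conj_symm] using h

/-- The divergence of `det h · h^{i j̄}`. -/
lemma sum_dzbar_det_mul_inv (L : LeeData U H t) (hz : z ∈ U) (i : Fin n) :
    ∑ j, ∂zb j (fun w => detComp H w * invComp H j i w) z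
      = detComp H z * ((n - 1) * ∑ j, invComp H j i z * conj (t j z)) := by
  have hdet : DifferentiableAt ℝ (detComp H) z :=
    ((contDiffOn_det L.smooth).differentiableOn (by simp)).differentiableAt (L.isOpen.mem_nhds hz)
  -- Jacobi's formula and the derivative of the inverse give two terms; exchanging `j` and `l` in
  -- the second makes their difference a contraction of the conjugate torsion.
  have h1 : ∀ j, ∂zb j (fun w => detComp H w * invComp H j i w) z
      = detComp H z * (∑ k, ∑ l, invComp H l k z * ∂zb j (H k l) z * invComp H j i z
        - ∑ k, ∑ l, invComp H j k z * ∂zb j (H k l) z * invComp H l i z) := by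
    intro j
    rw [wirt_mul hdet (L.diff_inv hz j i), L.wirt_inv hz,
      wirt_det (fun k l => L.diff hz k l) (L.det_ne hz)]
    simp only [← Finset.sum_mul]
    ring
  simp only [h1, ← Finset.mul_sum, Finset.sum_sub_distrib]
  congr 1
  have h2 : ∑ j, ∑ k, ∑ l, invComp H j k z * ∂zb j (H k l) z * invComp H l i z
      = ∑ j, ∑ k, ∑ l, invComp H l k z * ∂zb l (H k j) z * invComp H j i z := by
    rw [Finset.sum_comm]
    conv_rhs => rw [Finset.sum_comm]
    exact Finset.sum_congr rfl fun k _ => Finset.sum_comm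
  rw [h2]
  simp only [← Finset.sum_sub_distrib]
  -- In the contracted torsion, `n` is the trace of the metric and the subtracted term is the
  -- contraction over the other index, whence the factor `n - 1`.
  have h3 : ∀ j, ∑ k, ∑ l, (invComp H l k z * ∂zb j (H k l) z * invComp H j i z
      - invComp H l k z * ∂zb l (H k j) z * invComp H j i z)
      = (n * conj (t j z) - conj (t j z)) * invComp H j i z := by
    intro j
    have e1 := L.sum_sum_inv_mul_left hz (fun l => conj (t l z)) j
    rw [← L.trace_metric hz]
    conv_rhs =>
      enter [1, 2]
      rw [← e1]
    simp only [Finset.sum_mul, ← Finset.sum_sub_distrib]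
    refine Finset.sum_congr rfl fun k _ => Finset.sum_congr rfl fun l _ => ?_
    linear_combination invComp H l k z * invComp H j i z * L.conj_torsion hz j k l
  rw [Finset.mul_sum]
  refine Finset.sum_congr rfl fun j _ => ?_
  rw [h3]
  ring

/-- The divergence of the vector field `ψ θ^♯`. -/
lemma sum_dzbar_lee (L : LeeData U H t) (hz : z ∈ U) {ψ : Cn n → ℂ}
    (hψ : DifferentiableAt ℝ ψ z) :
    ∑ j, ∂zb j (fun w => ψ w * ∑ i, detComp H w * invComp H j i w * t i w) z
      = detComp H z * (ψ z * (trComp H (fun k l => ∂zb l (t k) z) z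
          + (n - 1) * trComp H (fun k l => t k z * conj (t l z)) z)
        + trComp H (fun k l => t k z * ∂zb l ψ z) z) := by
  have hdet : DifferentiableAt ℝ (detComp H) z :=
    ((contDiffOn_det L.smooth).differentiableOn (by simp)).differentiableAt (L.isOpen.mem_nhds hz)
  have hdi : ∀ j i, DifferentiableAt ℝ (fun w => detComp H w * invComp H j i w) z := fun j i =>
    hdet.mul (L.diff_inv hz j i)
  have h1 : ∀ j, ∂zb j (fun w => ψ w * ∑ i, detComp H w * invComp H j i w * t i w) z
      = ψ z * ∑ i, (detComp H z * invComp H j i z * ∂zb j (t i) z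
          + ∂zb j (fun w => detComp H w * invComp H j i w) z * t i z)
        + ∂zb j ψ z * ∑ i, detComp H z * invComp H j i z * t i z := by
    intro j
    rw [wirt_mul (G := fun w => ∑ i, detComp H w * invComp H j i w * t i w) hψ
        (DifferentiableAt.fun_sum fun i _ => (hdi j i).mul (L.diff_lee hz i)),
      wirt_sum_mul (F := fun i w => detComp H w * invComp H j i w) (G := t)
        (fun i _ => hdi j i) (fun i _ => L.diff_lee hz i)]
  have h2 : ∑ j, ∑ i, ∂zb j (fun w => detComp H w * invComp H j i w) z * t i z
      = detComp H z * ((n - 1) * trComp H (fun k l => t k z * conj (t l z)) z) := by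
    rw [Finset.sum_comm]
    simp only [← Finset.sum_mul, L.sum_dzbar_det_mul_inv hz, trComp, Finset.mul_sum]
    simp only [Finset.sum_mul]
    refine Finset.sum_congr rfl fun _ _ => Finset.sum_congr rfl fun _ _ => ?_
    ring
  have h3 : ∑ j, ∑ i, detComp H z * invComp H j i z * ∂zb j (t i) z
      = detComp H z * trComp H (fun k l => ∂zb l (t k) z) z := by
    rw [Finset.sum_comm]
    simp only [trComp, Finset.mul_sum]
    refine Finset.sum_congr rfl fun _ _ => Finset.sum_congr rfl fun _ _ => ?_
    ring
  have h4 : ∑ j, ∂zb j ψ z * ∑ i, detComp H z * invComp H j i z * t i z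
      = detComp H z * trComp H (fun k l => t k z * ∂zb l ψ z) z := by
    simp only [trComp, Finset.mul_sum]
    rw [Finset.sum_comm]
    refine Finset.sum_congr rfl fun _ _ => Finset.sum_congr rfl fun _ _ => ?_
    ring
  simp only [h1, Finset.sum_add_distrib, ← Finset.mul_sum, h4] at h2 h3 ⊢
  rw [h2, h3]
  ring

/-- The trace `h^{k l̄} θ_k θ̄_l` is the square of the norm of the Lee form. -/
lemma trComp_lee_eq (t' : Fin n → ℂ) (z : Cn n) :
    trComp H (fun k l => t' k * conj (t' l)) z
      = star t' ⬝ᵥ ((Matrix.of fun i j => H i j z)⁻¹.mulVec t') := by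
  rw [trComp, Finset.sum_comm]
  simp only [dotProduct, Matrix.mulVec, Finset.mul_sum, invComp]
  refine Finset.sum_congr rfl fun _ _ => Finset.sum_congr rfl fun _ _ => ?_
  simp only [Pi.star_apply, RCLike.star_def]
  ring

lemma trComp_lee_nonneg (L : LeeData U H t) (hz : z ∈ U) (t' : Fin n → ℂ) :
    0 ≤ (trComp H (fun k l => t' k * conj (t' l)) z).re := by
  rw [trComp_lee_eq]
  exact (L.posDef hz).inv.posSemidef.re_dotProduct_nonneg t'

lemma trComp_lee_pos (L : LeeData U H t) (hz : z ∈ U) {t' : Fin n → ℂ} (ht : t' ≠ 0) :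
    0 < (trComp H (fun k l => t' k * conj (t' l)) z).re := by
  rw [trComp_lee_eq]
  exact (L.posDef hz).inv.re_dotProduct_pos ht

lemma conj_trComp (L : LeeData U H t) {T : Fin n → Fin n → ℂ} (hT : ∀ i j, conj (T i j) = T j i)
    (z : Cn n) : conj (trComp H T z) = trComp H T z := by
  simp only [trComp, map_sum, map_mul, L.conj_inv, hT]
  exact Finset.sum_comm

end LeeData

/-! ### Exterior derivatives of 1-forms and 2-forms evaluated on vectors. -/

section ExteriorDerivative

variable {n : ℕ} {U : Set (Cn n)} {z : Cn n}

/-- A form is smooth as soon as all its values are. -/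
lemma contDiffOn_form {k : ℕ} {η : Cn n → Cn n [⋀^Fin k]→L[ℝ] ℝ}
    (h : ∀ v, ContDiffOn ℝ ∞ (fun w => η w v) U) : ContDiffOn ℝ ∞ η U := by
  let b := Module.finBasis ℝ (Cn n)
  let ev : (Cn n [⋀^Fin k]→L[ℝ] ℝ) →ₗ[ℝ]
      ((Fin k → Fin (Module.finrank ℝ (Cn n))) → ℝ) :=
    { toFun := fun f v => f fun i => b (v i)
      map_add' := fun _ _ => rfl
      map_smul' := fun _ _ => rfl }
  have hinj : LinearMap.ker ev = ⊥ := by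
    rw [LinearMap.ker_eq_bot]
    intro f g hfg
    apply ContinuousAlternatingMap.toAlternatingMap_injective
    exact b.ext_alternating fun v _ => congrFun hfg v
  obtain ⟨g, hg⟩ := LinearMap.exists_leftInverse_of_injective ev hinj
  have h1 : η = fun w => g.toContinuousLinearMap (ev (η w)) :=
    funext fun w => (LinearMap.congr_fun hg (η w)).symm
  rw [h1]
  exact g.toContinuousLinearMap.contDiff.comp_contDiffOn (contDiffOn_pi.2 fun v => h _)

lemma extDeriv_two_apply {η : Cn n → Cn n [⋀^Fin 2]→L[ℝ] ℝ} (hη : DifferentiableAt ℝ η z)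
    (u v w : Cn n) : extDeriv η z ![u, v, w]
      = fderiv ℝ (fun x => η x ![v, w]) z u - fderiv ℝ (fun x => η x ![u, w]) z v
        + fderiv ℝ (fun x => η x ![u, v]) z w := by
  have e0 : (0 : Fin 3).removeNth ![u, v, w] = ![v, w] := by
    ext i; fin_cases i <;> rfl
  have e1 : (1 : Fin 3).removeNth ![u, v, w] = ![u, w] := by
    ext i; fin_cases i <;> rfl
  have e2 : (2 : Fin 3).removeNth ![u, v, w] = ![u, v] := by
    ext i; fin_cases i <;> rfl
  rw [extDeriv_apply hη, Fin.sum_univ_three, e0, e1, e2]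
  simp
  ring

lemma extDeriv_one_apply {θ : Cn n → Cn n →L[ℝ] ℝ} (hθ : DifferentiableAt ℝ θ z) (u v : Cn n) :
    extDeriv (fun w => ContinuousAlternatingMap.ofSubsingleton ℝ (Cn n) ℝ (0 : Fin 1) (θ w)) z
      ![u, v] = fderiv ℝ θ z u v - fderiv ℝ θ z v u := by
  have e0 : (0 : Fin 2).removeNth ![u, v] = ![v] := by
    ext i; fin_cases i; rfl
  have e1 : (1 : Fin 2).removeNth ![u, v] = ![u] := by
    ext i; fin_cases i; rfl
  have h1 : ∀ x y, fderiv ℝ (fun w => θ w x) z y = fderiv ℝ θ z y x := by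
    intro x y
    rw [fderiv_clm_apply hθ (by fun_prop)]
    simp
  have hd : DifferentiableAt ℝ
      (fun w => ContinuousAlternatingMap.ofSubsingleton ℝ (Cn n) ℝ (0 : Fin 1) (θ w)) z :=
    (ContinuousAlternatingMap.ofSubsingletonLIE (𝕜 := ℝ) (E := Cn n) (F := ℝ) (0 : Fin 1)).differentiableAt.comp
      z hθ
  rw [extDeriv_apply hd, Fin.sum_univ_two, e0, e1]
  simp [h1]
  ring

end ExteriorDerivative

/-! ### From forms on the manifold to components in a chart. -/

section LeeComponents

variable {n : ℕ} {M : Type*} [TopologicalSpace M] [ChartedSpace (Cn n) M]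
  {e : OpenPartialHomeomorph M (Cn n)} {z : Cn n}

/-- The components `h_{i j̄}` as functions on the range of the chart. -/
def HermitianMetric.compFn (h : HermitianMetric n M) (e : OpenPartialHomeomorph M (Cn n))
    (i j : Fin n) (z : Cn n) : ℂ :=
  h.comp e z i j

/-- The component `θ_i = θ(∂/∂zⁱ)` of a real 1-form. -/
def OneForm.compFn (θ : OneForm n M) (e : OpenPartialHomeomorph M (Cn n)) (i : Fin n)
    (z : Cn n) : ℂ :=
  (θ.inChart e z (EuclideanSpace.single i 1)
    - Complex.I * θ.inChart e z (EuclideanSpace.single i Complex.I)) / 2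

lemma HermitianMetric.form_coordMap (h : HermitianMetric n M)
    (e : OpenPartialHomeomorph M (Cn n)) (z u v : Cn n) :
    h.form (e.symm z) (coordMap e z u) (coordMap e z v)
      = ∑ i, ∑ j, h.compFn e i j z * u i * conj (v j) := by
  conv_lhs => rw [sum_single_eq u, sum_single_eq v]
  simp only [map_sum, map_smul, ContinuousLinearMap.map_smulₛₗ, sum_apply,
    smul_apply, smul_eq_mul]
  rw [Finset.sum_comm]
  refine Finset.sum_congr rfl fun i _ => Finset.sum_congr rfl fun j _ => ?_
  rw [HermitianMetric.compFn, HermitianMetric.comp, Matrix.of_apply, coordVec, coordVec]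
  ring

lemma HermitianMetric.fundForm_apply (h : HermitianMetric n M)
    (e : OpenPartialHomeomorph M (Cn n)) (z : Cn n) (v : Fin 2 → Cn n) : h.fundForm e z v
      = -2 * (∑ i, ∑ j, h.compFn e i j z * v 0 i * conj (v 1 j)).im := by
  rw [← h.form_coordMap]
  rfl

lemma HermitianMetric.contDiffOn_compFn (h : HermitianMetric n M) (he : e ∈ atlas (Cn n) M)
    (i j : Fin n) : ContDiffOn ℝ ∞ (h.compFn e i j) e.target :=
  h.smooth e he i j

lemma HermitianMetric.contDiffOn_fundForm (h : HermitianMetric n M) (he : e ∈ atlas (Cn n) M) :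
    ContDiffOn ℝ ∞ (h.fundForm e) e.target := by
  refine contDiffOn_form fun v => ?_
  simp only [h.fundForm_apply]
  refine contDiffOn_const.mul (Complex.imCLM.contDiff.comp_contDiffOn ?_)
  exact ContDiffOn.sum fun i _ => ContDiffOn.sum fun j _ =>
    ((h.contDiffOn_compFn he i j).mul contDiffOn_const).mul contDiffOn_const

lemma HermitianMetric.differentiableAt_fundForm (h : HermitianMetric n M)
    (he : e ∈ atlas (Cn n) M) (hz : z ∈ e.target) : DifferentiableAt ℝ (h.fundForm e) z :=
  ((h.contDiffOn_fundForm he).differentiableOn (by simp)).differentiableAt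
    (e.open_target.mem_nhds hz)

lemma HermitianMetric.fundForm_single (h : HermitianMetric n M)
    (e : OpenPartialHomeomorph M (Cn n)) (z : Cn n) (i j : Fin n) (a b : ℂ) :
    h.fundForm e z ![EuclideanSpace.single i a, EuclideanSpace.single j b]
      = -2 * (h.compFn e i j z * (a * conj b)).im := by
  rw [h.fundForm_apply]
  simp [apply_ite, mul_assoc]

lemma HermitianMetric.fderiv_fundForm_single (h : HermitianMetric n M)
    (he : e ∈ atlas (Cn n) M) (hz : z ∈ e.target) (i j : Fin n) (a b : ℂ) (u : Cn n) :
    fderiv ℝ (fun x => h.fundForm e x ![EuclideanSpace.single i a, EuclideanSpace.single j b]) z u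
      = -2 * (fderiv ℝ (h.compFn e i j) z u * (a * conj b)).im := by
  have hd : DifferentiableAt ℝ (h.compFn e i j) z :=
    ((h.contDiffOn_compFn he i j).differentiableOn (by simp)).differentiableAt
      (e.open_target.mem_nhds hz)
  have h1 := (Complex.imCLM.hasFDerivAt.comp z (hd.hasFDerivAt.mul_const (a * conj b))).const_mul
    (-2 : ℝ)
  simp only [h.fundForm_single]
  refine (congrArg (fun L => L u) h1.fderiv).trans ?_
  simp [mul_comm]

lemma coordMap_injective [IsManifold 𝓘(ℂ, Cn n) ω M] (he : e ∈ atlas (Cn n) M)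
    (hz : z ∈ e.target) : Function.Injective (coordMap e z) := by
  have : IsManifold 𝓘(ℂ, Cn n) 1 M := IsManifold.of_le (n := ω) (by simp)
  have h1 := (mdifferentiable_of_mem_atlas (I := 𝓘(ℂ, Cn n)) he).comp_symm_deriv hz
  intro u v huv
  have h2 := congrArg (fun L => L u) h1
  have h3 := congrArg (fun L => L v) h1
  exact h2.symm.trans ((congrArg (mfderiv 𝓘(ℂ, Cn n) 𝓘(ℂ, Cn n) e (e.symm z)) huv).trans h3)

lemma OneForm.differentiableAt_inChart {θ : OneForm n M} (hs : θ.IsSmooth)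
    (he : e ∈ atlas (Cn n) M) (hz : z ∈ e.target) : DifferentiableAt ℝ (θ.inChart e) z :=
  ((hs e he).differentiableOn (by simp)).differentiableAt (e.open_target.mem_nhds hz)

lemma OneForm.fderiv_compFn {θ : OneForm n M} (hs : θ.IsSmooth) (he : e ∈ atlas (Cn n) M)
    (hz : z ∈ e.target) (i : Fin n) (u : Cn n) : fderiv ℝ (θ.compFn e i) z u
      = (fderiv ℝ (θ.inChart e) z u (EuclideanSpace.single i 1)
        - Complex.I * fderiv ℝ (θ.inChart e) z u (EuclideanSpace.single i Complex.I)) / 2 := by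
  have hd := OneForm.differentiableAt_inChart hs he hz
  have h1 : ∀ v : Cn n, HasFDerivAt (fun x => ((θ.inChart e x v : ℝ) : ℂ))
      (Complex.ofRealCLM.comp ((fderiv ℝ (θ.inChart e) z).flip v)) z := fun v => by
    refine Complex.ofRealCLM.hasFDerivAt.comp z ?_
    simpa using hd.hasFDerivAt.clm_apply (hasFDerivAt_const v z)
  have h2 := ((h1 (EuclideanSpace.single i 1)).sub
    ((h1 (EuclideanSpace.single i Complex.I)).const_mul Complex.I)).mul_const (2⁻¹ : ℂ)
  have h3 : θ.compFn e i = fun x => ((θ.inChart e x (EuclideanSpace.single i 1) : ℝ)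
    - Complex.I * (θ.inChart e x (EuclideanSpace.single i Complex.I) : ℝ)) * (2⁻¹ : ℂ) := by
    funext x; rw [OneForm.compFn, div_eq_mul_inv]
  rw [h3]
  refine (congrArg (fun L => L u) h2.fderiv).trans ?_
  simp [div_eq_mul_inv]
  ring

lemma OneForm.contDiffOn_compFn {θ : OneForm n M} (hs : θ.IsSmooth) (he : e ∈ atlas (Cn n) M)
    (i : Fin n) : ContDiffOn ℝ ∞ (θ.compFn e i) e.target := by
  have h1 : ∀ v : Cn n, ContDiffOn ℝ ∞ (fun x => ((θ.inChart e x v : ℝ) : ℂ)) e.target := fun v =>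
    Complex.ofRealCLM.contDiff.comp_contDiffOn ((hs e he).clm_apply contDiffOn_const)
  exact ((h1 _).sub (contDiffOn_const.mul (h1 _))).div_const 2

/-- The components of a locally conformal Kähler metric and of its Lee form in a chart. -/
theorem HermitianMetric.leeData [IsManifold 𝓘(ℂ, Cn n) ω M] (h : HermitianMetric n M)
    {θ : OneForm n M} (hs : θ.IsSmooth) (hcl : θ.IsClosed)
    (hd : ∀ e ∈ atlas (Cn n) M, ∀ z ∈ e.target, ∀ u v w : Cn n,
      extDeriv (h.fundForm e) z ![u, v, w] =
        θ.inChart e z u * h.fundForm e z ![v, w] - θ.inChart e z v * h.fundForm e z ![u, w]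
          + θ.inChart e z w * h.fundForm e z ![u, v])
    (he : e ∈ atlas (Cn n) M) : LeeData e.target (h.compFn e) (θ.compFn e) where
  isOpen := e.open_target
  smooth := h.contDiffOn_compFn he
  smooth_lee := OneForm.contDiffOn_compFn hs he
  conj_symm z i j := h.conj_symm _ _ _
  pos z hz X hX := by
    have h1 := h.form_coordMap e z (WithLp.toLp 2 X) (WithLp.toLp 2 X)
    simp only at h1
    rw [← h1]
    refine h.pos _ _ fun h0 => hX ?_
    have h2 := coordMap_injective he hz (h0.trans (map_zero (coordMap e z)).symm)
    exact (WithLp.toLp_eq_zero 2).1 h2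
  torsion z hz m i j := by
    have key : ∀ a b c : ℂ, -2 * (fderiv ℝ (h.compFn e i j) z (EuclideanSpace.single m a)
            * (b * conj c)).im
          - -2 * (fderiv ℝ (h.compFn e m j) z (EuclideanSpace.single i b) * (a * conj c)).im
          + -2 * (fderiv ℝ (h.compFn e m i) z (EuclideanSpace.single j c) * (a * conj b)).im
        = θ.inChart e z (EuclideanSpace.single m a) * (-2 * (h.compFn e i j z * (b * conj c)).im)
          - θ.inChart e z (EuclideanSpace.single i b) * (-2 * (h.compFn e m j z * (a * conj c)).im)
          + θ.inChart e z (EuclideanSpace.single j c)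
            * (-2 * (h.compFn e m i z * (a * conj b)).im) := by
      intro a b c
      have h1 := hd e he z hz (EuclideanSpace.single m a) (EuclideanSpace.single i b)
        (EuclideanSpace.single j c)
      rw [extDeriv_two_apply (h.differentiableAt_fundForm he hz)] at h1
      rw [h.fderiv_fundForm_single he hz, h.fderiv_fundForm_single he hz,
        h.fderiv_fundForm_single he hz] at h1
      simpa only [h.fundForm_single] using h1
    -- Taking `a, b, c` in `{1, √-1}` gives eight real equations, from which the component on `(∂_m,
    -- ∂_i, ∂_{j̄})` is extracted. The equations with an odd number of factors `√-1` give its real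
    -- part, the others its imaginary part.
    have k1 := key 1 1 1
    have k2 := key Complex.I 1 1
    have k3 := key 1 Complex.I 1
    have k4 := key 1 1 Complex.I
    have k5 := key Complex.I Complex.I 1
    have k6 := key Complex.I 1 Complex.I
    have k7 := key 1 Complex.I Complex.I
    have k8 := key Complex.I Complex.I Complex.I
    simp only [map_one, Complex.conj_I, mul_one, one_mul, mul_neg, Complex.I_mul_I, neg_neg,
      Complex.neg_im, Complex.mul_im, Complex.I_re, Complex.I_im, mul_zero] at *
    apply Complex.ext
    · simp only [wirt, OneForm.compFn, Complex.sub_re, Complex.mul_re, Complex.add_re,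
        Complex.div_re, Complex.normSq_ofNat, Complex.sub_im, Complex.mul_im, Complex.add_im,
        Complex.div_im, Complex.neg_re, Complex.neg_im, Complex.I_re, Complex.I_im,
        Complex.ofReal_re, Complex.ofReal_im, Complex.re_ofNat, Complex.im_ofNat] at *
      linear_combination (-k2 - k3 + k4 - k8) / 8
    · simp only [wirt, OneForm.compFn, Complex.sub_re, Complex.mul_re, Complex.add_re,
        Complex.div_re, Complex.normSq_ofNat, Complex.sub_im, Complex.mul_im, Complex.add_im,
        Complex.div_im, Complex.neg_re, Complex.neg_im, Complex.I_re, Complex.I_im,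
        Complex.ofReal_re, Complex.ofReal_im, Complex.re_ofNat, Complex.im_ofNat] at *
      linear_combination -(k1 - k5 + k6 + k7) / 8
  dz_lee z hz i j := by
    have hsymm : ∀ u v, fderiv ℝ (θ.inChart e) z u v = fderiv ℝ (θ.inChart e) z v u := by
      intro u v
      have h1 := extDeriv_one_apply (OneForm.differentiableAt_inChart hs he hz) u v
      rw [hcl e he z hz] at h1
      exact (sub_eq_zero.1 h1.symm)
    simp only [wirt, OneForm.fderiv_compFn hs he hz]
    rw [hsymm (EuclideanSpace.single j 1), hsymm (EuclideanSpace.single j 1),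
      hsymm (EuclideanSpace.single j Complex.I), hsymm (EuclideanSpace.single j Complex.I)]
    ring
  dzbar_lee z hz i j := by
    have hsymm : ∀ u v, fderiv ℝ (θ.inChart e) z u v = fderiv ℝ (θ.inChart e) z v u := by
      intro u v
      have h1 := extDeriv_one_apply (OneForm.differentiableAt_inChart hs he hz) u v
      rw [hcl e he z hz] at h1
      exact (sub_eq_zero.1 h1.symm)
    simp only [wirt, OneForm.fderiv_compFn hs he hz]
    simp only [map_div₀, map_add, map_sub, map_mul, Complex.conj_I, Complex.conj_ofReal,
      Complex.conj_ofNat]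
    rw [hsymm (EuclideanSpace.single j 1), hsymm (EuclideanSpace.single j 1),
      hsymm (EuclideanSpace.single j Complex.I), hsymm (EuclideanSpace.single j Complex.I)]
    ring

end LeeComponents

/-! ### Holomorphic coordinate changes. -/

section HolomorphicChange

variable {n : ℕ} {τ : Cn n → Cn n} {z : Cn n}

/-- The holomorphic Jacobian matrix `∂τᵃ/∂zᵏ`. -/
def jac (τ : Cn n → Cn n) (z : Cn n) : Matrix (Fin n) (Fin n) ℂ :=
  Matrix.of fun a k => fderiv ℂ τ z (EuclideanSpace.single k 1) a

lemma fderiv_apply_eq_jac (z u : Cn n) (a : Fin n) :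
    fderiv ℂ τ z u a = ∑ k, jac τ z a k * u k := by
  conv_lhs => rw [sum_single_eq u]
  simp [jac, mul_comm]

/-- The real determinant of a complex linear map is the squared modulus of the complex one. This is
also the factor by which `det h` changes, so `det h` times Lebesgue measure is independent of
coordinates. -/
lemma abs_det_fderiv (hτ : DifferentiableAt ℂ τ z) :
    |(fderiv ℝ τ z).det| = Complex.normSq (jac τ z).det := by
  have h1 : fderiv ℝ τ z = (fderiv ℂ τ z).restrictScalars ℝ := hτ.fderiv_restrictScalars ℝ
  have h2 : (fderiv ℝ τ z).det = Complex.normSq (jac τ z).det := by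
    rw [h1, ContinuousLinearMap.det]
    refine (LinearMap.det_restrictScalars (R := ℝ) (S := ℂ) (A := Cn n)
      (f := (fderiv ℂ τ z).toLinearMap)).trans ?_
    rw [Algebra.norm_complex_apply,
      ← LinearMap.det_toMatrix (EuclideanSpace.basisFun (Fin n) ℂ).toBasis]
    congr 2
  rw [h2, abs_of_nonneg (Complex.normSq_nonneg _)]

lemma dzbar_eq_zero {G : Cn n → ℂ} (hG : DifferentiableAt ℂ G z) (l : Fin n) :
    ∂zb l G z = 0 := by
  have h1 : fderiv ℝ G z = (fderiv ℂ G z).restrictScalars ℝ := hG.fderiv_restrictScalars ℝ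
  rw [wirt, h1, single_eq_smul l Complex.I]
  simp only [ContinuousLinearMap.coe_restrictScalars', map_smul, smul_eq_mul]
  linear_combination (fderiv ℂ G z (EuclideanSpace.single l 1)) / 2 * Complex.I_mul_I

/-- Since `τ` is holomorphic, the chain rule for `∂̄` has no term in `∂F`. -/
lemma dzbar_comp {F : Cn n → ℂ} (hF : DifferentiableAt ℝ F (τ z)) (hτ : DifferentiableAt ℂ τ z)
    (l : Fin n) :
    ∂zb l (fun w => F (τ w)) z = ∑ b, ∂zb b F (τ z) * conj (jac τ z b l) := by
  have h1 : fderiv ℝ τ z = (fderiv ℂ τ z).restrictScalars ℝ := hτ.fderiv_restrictScalars ℝ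
  have h2 : fderiv ℝ (fun w => F (τ w)) z
      = (fderiv ℝ F (τ z)).comp ((fderiv ℂ τ z).restrictScalars ℝ) := by
    rw [← h1]
    exact fderiv_comp z hF (hτ.restrictScalars ℝ)
  rw [wirt, h2]
  simp only [ContinuousLinearMap.comp_apply, ContinuousLinearMap.coe_restrictScalars',
    fderiv_apply_eq_wirt, fderiv_apply_eq_jac]
  rw [Finset.mul_sum, ← Finset.sum_add_distrib, Finset.sum_div]
  refine Finset.sum_congr rfl fun b _ => ?_
  simp
  linear_combination (jac τ z b l * ∂z b F (τ z)
    - conj (jac τ z b l) * ∂zb b F (τ z)) / 2 * Complex.I_mul_I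

/-- The trace is invariant under the change of components of sesquilinear forms. -/
lemma trComp_eq_of_change {H H' : Fin n → Fin n → Cn n → ℂ} {T T' : Fin n → Fin n → ℂ}
    {z' : Cn n} {J : Matrix (Fin n) (Fin n) ℂ} (hJ : J.det ≠ 0)
    (hH : ∀ i j, H i j z = ∑ a, ∑ b, H' a b z' * J a i * conj (J b j))
    (hT : ∀ i j, T i j = ∑ a, ∑ b, T' a b * J a i * conj (J b j)) :
    trComp H T z = trComp H' T' z' := by
  -- In matrix form `H = Jᵀ H' J̄` and `T = Jᵀ T' J̄`, so `tr (H⁻¹ T)` is unchanged by cyclicity of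
  -- the trace.
  have mat : ∀ S : Fin n → Fin n → ℂ,
      (Matrix.of fun i j => ∑ a, ∑ b, S a b * J a i * conj (J b j))
        = J.transpose * Matrix.of S * J.map conj := by
    intro S
    ext i j
    simp only [Matrix.mul_apply, Matrix.of_apply, Matrix.transpose_apply, Matrix.map_apply,
      Finset.sum_mul]
    rw [Finset.sum_comm]
    refine Finset.sum_congr rfl fun _ _ => Finset.sum_congr rfl fun _ _ => ?_
    ring
  have tr : ∀ (H : Fin n → Fin n → Cn n → ℂ) (T : Fin n → Fin n → ℂ) (z : Cn n),
      trComp H T z = ((Matrix.of fun i j => H i j z)⁻¹ * Matrix.of T).trace := by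
    intro H T z
    rw [trComp, Finset.sum_comm, Matrix.trace]
    rfl
  have h1 : IsUnit J.transpose.det := by simpa using hJ
  have h2 : IsUnit (J.map conj).det := by
    have : (J.map conj).det = conj J.det := ((starRingEnd ℂ).map_det J).symm
    rw [this]
    simpa using hJ
  rw [tr, tr]
  simp only [hH]
  rw [show Matrix.of T = Matrix.of fun i j => ∑ a, ∑ b, T' a b * J a i * conj (J b j) by
    ext i j; exact hT i j, mat, mat]
  rw [Matrix.mul_inv_rev, Matrix.mul_inv_rev, Matrix.trace_mul_comm]
  simp only [Matrix.mul_assoc]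
  rw [Matrix.mul_nonsing_inv_cancel_left _ _ h2, ← Matrix.mul_assoc, ← Matrix.mul_assoc,
    Matrix.trace_mul_comm]
  simp only [Matrix.mul_assoc]
  rw [Matrix.nonsing_inv_mul_cancel_left _ _ h1, Matrix.trace_mul_comm]

lemma detComp_eq_of_change {H H' : Fin n → Fin n → Cn n → ℂ}
    {z' : Cn n} {J : Matrix (Fin n) (Fin n) ℂ}
    (hH : ∀ i j, H i j z = ∑ a, ∑ b, H' a b z' * J a i * conj (J b j)) :
    detComp H z = Complex.normSq J.det * detComp H' z' := by
  have mat : (Matrix.of fun i j => H i j z)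
        = J.transpose * (Matrix.of fun i j => H' i j z') * J.map conj := by
    ext i j
    simp only [Matrix.mul_apply, Matrix.of_apply, Matrix.transpose_apply, Matrix.map_apply,
      Finset.sum_mul, hH]
    rw [Finset.sum_comm]
    refine Finset.sum_congr rfl fun _ _ => Finset.sum_congr rfl fun _ _ => ?_
    ring
  have h2 : (J.map conj).det = conj J.det := ((starRingEnd ℂ).map_det J).symm
  rw [detComp, mat, Matrix.det_mul, Matrix.det_mul, Matrix.det_transpose, h2, detComp,
    ← Complex.mul_conj]
  ring

end HolomorphicChange

/-! ### Invariance of the scalars built from the metric and the Lee form. -/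

section ChartChange

lemma mem_chartChange_source {X Y : Type*} [TopologicalSpace X] [TopologicalSpace Y]
    {e e' : OpenPartialHomeomorph X Y} {z : Y} (hz : z ∈ e.target) (hz' : e.symm z ∈ e'.source) :
    z ∈ (e.symm.trans e').source := by
  simp [hz, hz']

lemma eventually_chartChange {X Y : Type*} [TopologicalSpace X] [TopologicalSpace Y]
    {e e' : OpenPartialHomeomorph X Y} {z : Y} (hz : z ∈ e.target) (hz' : e.symm z ∈ e'.source) :
    ∀ᶠ w in 𝓝 z, w ∈ e.target ∧ e.symm w ∈ e'.source :=
  Filter.mem_of_superset ((e.symm.trans e').open_source.mem_nhds (mem_chartChange_source hz hz'))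
    fun w hw => by simpa using hw

variable {n : ℕ} {M : Type*} [TopologicalSpace M] [ChartedSpace (Cn n) M]
  {e e' : OpenPartialHomeomorph M (Cn n)} {z : Cn n}

lemma OneForm.inChart_eq (θ : OneForm n M) (e : OpenPartialHomeomorph M (Cn n)) (z u : Cn n) :
    (θ.inChart e z u - Complex.I * θ.inChart e z (Complex.I • u)) / 2
      = ∑ a, θ.compFn e a z * u a := by
  have h1 := fun v => real_linear_apply (θ.inChart e z).toLinearMap v
  simp only [ContinuousLinearMap.coe_coe] at h1
  rw [h1 u, h1 (Complex.I • u)]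
  simp only [Complex.ofReal_sum, Finset.mul_sum, ← Finset.sum_sub_distrib, Finset.sum_div]
  refine Finset.sum_congr rfl fun a _ => ?_
  simp [OneForm.compFn]
  linear_combination (θ.inChart e z (EuclideanSpace.single a 1)
    - Complex.I * θ.inChart e z (EuclideanSpace.single a Complex.I)) / 2
      * Complex.re_add_im (u a)
    + (u a).im * (θ.inChart e z (EuclideanSpace.single a Complex.I)) / 2 * Complex.I_mul_I

lemma contDiffOn_chartChange [IsManifold 𝓘(ℂ, Cn n) ω M] (he : e ∈ atlas (Cn n) M)
    (he' : e' ∈ atlas (Cn n) M) :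
    ContDiffOn ℂ ω (e' ∘ e.symm) (e.symm.trans e').source := by
  have h1 := ((contDiffGroupoid ω 𝓘(ℂ, Cn n)).compatible he he').1
  simpa [contDiffPregroupoid] using h1

/-- The real manifold underlying a complex manifold. -/
lemma isManifold_real [IsManifold 𝓘(ℂ, Cn n) ω M] : IsManifold 𝓘(ℝ, Cn n) ∞ M := by
  refine isManifold_of_contDiffOn 𝓘(ℝ, Cn n) ∞ M fun e e' he he' => ?_
  simpa using ((contDiffOn_chartChange he he').restrict_scalars ℝ).of_le le_top

variable [IsManifold 𝓘(ℂ, Cn n) ω M]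

lemma differentiableAt_chartChange (he : e ∈ atlas (Cn n) M) (he' : e' ∈ atlas (Cn n) M)
    (hz : z ∈ e.target) (hz' : e.symm z ∈ e'.source) :
    DifferentiableAt ℂ (e' ∘ e.symm) z :=
  ((contDiffOn_chartChange he he').differentiableOn (by simp)).differentiableAt
    ((e.symm.trans e').open_source.mem_nhds (mem_chartChange_source hz hz'))

/-- The chain rule for `e.symm = e'.symm ∘ (e' ∘ e.symm)`. The two tangent vectors sit over points
that are only propositionally equal, so they are compared in the model space `Cn n`. -/
lemma coordMap_chartChange (he : e ∈ atlas (Cn n) M) (he' : e' ∈ atlas (Cn n) M)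
    (hz : z ∈ e.target) (hz' : e.symm z ∈ e'.source) (u : Cn n) :
    (coordMap e z u : Cn n)
      = coordMap e' (e' (e.symm z)) (fderiv ℂ (e' ∘ e.symm) z u) := by
  have : IsManifold 𝓘(ℂ, Cn n) 1 M := IsManifold.of_le (n := ω) (by simp)
  have h1 := mdifferentiable_of_mem_atlas (I := 𝓘(ℂ, Cn n)) he
  have h1' := mdifferentiable_of_mem_atlas (I := 𝓘(ℂ, Cn n)) he'
  have h2 := h1'.symm_comp_deriv hz'
  have h3 := mfderiv_comp z (h1'.mdifferentiableAt hz') (h1.mdifferentiableAt_symm hz)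
  rw [mfderiv_eq_fderiv] at h3
  have h4 := congrArg (fun L => L u) h3
  have h5 := congrArg (fun L => L (coordMap e z u)) h2
  refine h5.symm.trans ?_
  exact (congrArg (mfderiv 𝓘(ℂ, Cn n) 𝓘(ℂ, Cn n) e'.symm (e' (e.symm z))) h4).symm

/-- A kernel vector of the Jacobian would be killed by the injective map `coordMap e z`. -/
lemma det_jac_chartChange_ne (he : e ∈ atlas (Cn n) M) (he' : e' ∈ atlas (Cn n) M)
    (hz : z ∈ e.target) (hz' : e.symm z ∈ e'.source) : (jac (e' ∘ e.symm) z).det ≠ 0 := by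
  intro h0
  obtain ⟨v, hv, hv0⟩ := Matrix.exists_mulVec_eq_zero_iff.2 h0
  refine hv ((WithLp.toLp_eq_zero 2).1 (coordMap_injective he hz (a₁ := WithLp.toLp 2 v) ?_))
  have h1 := coordMap_chartChange he he' hz hz'
  have h2 : fderiv ℂ (e' ∘ e.symm) z (WithLp.toLp 2 v) = 0 := by
    ext a
    rw [fderiv_apply_eq_jac]
    exact congrFun hv0 a
  refine (h1 _).trans (Eq.trans ?_ (h1 0).symm)
  simp only [h2, map_zero]
  rfl

lemma HermitianMetric.compFn_chartChange (h : HermitianMetric n M) (he : e ∈ atlas (Cn n) M)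
    (he' : e' ∈ atlas (Cn n) M) (hz : z ∈ e.target) (hz' : e.symm z ∈ e'.source) (i j : Fin n) :
    h.compFn e i j z = ∑ a, ∑ b, h.compFn e' a b (e' (e.symm z)) * jac (e' ∘ e.symm) z a i
      * conj (jac (e' ∘ e.symm) z b j) := by
  -- `F` forgets that the tangent space depends on the point, which makes it possible to rewrite the
  -- base point.
  let F : M → Cn n → Cn n → ℂ := fun p X Y => h.form p X Y
  have h1 : h.compFn e i j z = F (e.symm z) (coordMap e z (EuclideanSpace.single i 1))
    (coordMap e z (EuclideanSpace.single j 1)) := rfl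
  have h2 := h.form_coordMap e' (e' (e.symm z))
    (fderiv ℂ (e' ∘ e.symm) z (EuclideanSpace.single i 1))
    (fderiv ℂ (e' ∘ e.symm) z (EuclideanSpace.single j 1))
  have h3 : F (e'.symm (e' (e.symm z))) = F (e.symm z) := by rw [e'.left_inv hz']
  rw [h1, coordMap_chartChange he he' hz hz', coordMap_chartChange he he' hz hz', ← h3]
  exact h2

lemma OneForm.compFn_chartChange (θ : OneForm n M) (he : e ∈ atlas (Cn n) M)
    (he' : e' ∈ atlas (Cn n) M) (hz : z ∈ e.target) (hz' : e.symm z ∈ e'.source) (i : Fin n) :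
    θ.compFn e i z = ∑ a, θ.compFn e' a (e' (e.symm z)) * jac (e' ∘ e.symm) z a i := by
  let F : M → Cn n → ℝ := fun p X => θ p X
  have h3 : F (e'.symm (e' (e.symm z))) = F (e.symm z) := by rw [e'.left_inv hz']
  have h1 : ∀ u, θ.inChart e z u
      = θ.inChart e' (e' (e.symm z)) (fderiv ℂ (e' ∘ e.symm) z u) := by
    intro u
    have e1 : θ.inChart e z u = F (e.symm z) (coordMap e z u) := rfl
    rw [e1, coordMap_chartChange he he' hz hz', ← h3]
    rfl
  have h2 := θ.inChart_eq e' (e' (e.symm z))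
    (fderiv ℂ (e' ∘ e.symm) z (EuclideanSpace.single i 1))
  rw [← map_smul, ← h1, ← h1, ← single_eq_smul] at h2
  exact h2

/-- Invariance of `tr θ_{i, j̄}`. -/
lemma trComp_dzbar_lee_chartChange (h : HermitianMetric n M) {θ : OneForm n M} (hs : θ.IsSmooth)
    (he : e ∈ atlas (Cn n) M) (he' : e' ∈ atlas (Cn n) M) (hz : z ∈ e.target)
    (hz' : e.symm z ∈ e'.source) :
    trComp (h.compFn e) (fun k l => ∂zb l (θ.compFn e k) z) z
      = trComp (h.compFn e') (fun k l => ∂zb l (θ.compFn e' k) (e' (e.symm z)))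
          (e' (e.symm z)) := by
  refine trComp_eq_of_change (det_jac_chartChange_ne he he' hz hz')
    (fun i j => h.compFn_chartChange he he' hz hz' i j) fun i j => ?_
  have hd := differentiableAt_chartChange he he' hz hz'
  have h1 : θ.compFn e i =ᶠ[𝓝 z] fun w => ∑ a, θ.compFn e' a ((e' ∘ e.symm) w)
      * jac (e' ∘ e.symm) w a i := by
    filter_upwards [eventually_chartChange hz hz'] with w hw
    exact θ.compFn_chartChange he he' hw.1 hw.2 i
  -- The Jacobian is itself holomorphic and so is annihilated by `∂̄`; this is why `θ_{i,j̄}`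
  -- transforms as a tensor.
  have h2 : ∀ a, DifferentiableAt ℂ (fun w => jac (e' ∘ e.symm) w a i) z := by
    intro a
    have e1 : ContDiffOn ℂ ω (fderiv ℂ (e' ∘ e.symm)) (e.symm.trans e').source :=
      (contDiffOn_chartChange he he').fderiv_of_isOpen (e.symm.trans e').open_source (by simp)
    have e2 : DifferentiableAt ℂ (fderiv ℂ (e' ∘ e.symm)) z :=
      (e1.differentiableOn (by simp)).differentiableAt
        ((e.symm.trans e').open_source.mem_nhds (mem_chartChange_source hz hz'))
    have e3 : DifferentiableAt ℂ
        (fun w => fderiv ℂ (e' ∘ e.symm) w (EuclideanSpace.single i 1)) z :=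
      e2.clm_apply (differentiableAt_const _)
    exact (EuclideanSpace.proj (𝕜 := ℂ) a).differentiableAt.comp z e3
  have h3 : ∀ a, DifferentiableAt ℝ (θ.compFn e' a) ((e' ∘ e.symm) z) := fun a =>
    ((OneForm.contDiffOn_compFn hs he' a).differentiableOn (by simp)).differentiableAt
      (e'.open_target.mem_nhds (e'.map_source hz'))
  rw [wirt_congr h1, wirt_sum_mul (F := fun a w => θ.compFn e' a ((e' ∘ e.symm) w))
    (G := fun a w => jac (e' ∘ e.symm) w a i)
    (fun a _ => (h3 a).comp z (hd.restrictScalars ℝ)) (fun a _ => (h2 a).restrictScalars ℝ)]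
  refine Finset.sum_congr rfl fun a _ => ?_
  rw [dzbar_eq_zero (h2 a), dzbar_comp (h3 a) hd, mul_zero, zero_add, Finset.sum_mul]
  refine Finset.sum_congr rfl fun b _ => ?_
  simp only [Function.comp_apply]
  ring

/-- Invariance of `|θ|²`. -/
lemma trComp_lee_chartChange (h : HermitianMetric n M) (θ : OneForm n M)
    (he : e ∈ atlas (Cn n) M) (he' : e' ∈ atlas (Cn n) M) (hz : z ∈ e.target)
    (hz' : e.symm z ∈ e'.source) :
    trComp (h.compFn e) (fun k l => θ.compFn e k z * conj (θ.compFn e l z)) z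
      = trComp (h.compFn e') (fun k l => θ.compFn e' k (e' (e.symm z))
          * conj (θ.compFn e' l (e' (e.symm z)))) (e' (e.symm z)) := by
  refine trComp_eq_of_change (det_jac_chartChange_ne he he' hz hz')
    (fun i j => h.compFn_chartChange he he' hz hz' i j) fun i j => ?_
  rw [θ.compFn_chartChange he he' hz hz' i, θ.compFn_chartChange he he' hz hz' j]
  simp only [map_sum, map_mul, Finset.sum_mul, Finset.mul_sum]
  rw [Finset.sum_comm]
  refine Finset.sum_congr rfl fun _ _ => Finset.sum_congr rfl fun _ _ => ?_
  ring

/-- Invariance of the derivative of a function in the direction of `θ^♯`. -/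
lemma trComp_lee_fun_chartChange (h : HermitianMetric n M) (θ : OneForm n M) {ψ : M → ℂ}
    (hψ : ContDiffOn ℝ ∞ (ψ ∘ e'.symm) e'.target)
    (he : e ∈ atlas (Cn n) M) (he' : e' ∈ atlas (Cn n) M) (hz : z ∈ e.target)
    (hz' : e.symm z ∈ e'.source) :
    trComp (h.compFn e) (fun k l => θ.compFn e k z * ∂zb l (ψ ∘ e.symm) z) z
      = trComp (h.compFn e') (fun k l => θ.compFn e' k (e' (e.symm z))
          * ∂zb l (ψ ∘ e'.symm) (e' (e.symm z))) (e' (e.symm z)) := by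
  refine trComp_eq_of_change (det_jac_chartChange_ne he he' hz hz')
    (fun i j => h.compFn_chartChange he he' hz hz' i j) fun i j => ?_
  have h1 : ψ ∘ e.symm =ᶠ[𝓝 z] fun w => (ψ ∘ e'.symm) ((e' ∘ e.symm) w) := by
    filter_upwards [eventually_chartChange hz hz'] with w hw
    simp [e'.left_inv hw.2]
  have h2 : DifferentiableAt ℝ (ψ ∘ e'.symm) ((e' ∘ e.symm) z) :=
    (hψ.differentiableOn (by simp)).differentiableAt
      (e'.open_target.mem_nhds (e'.map_source hz'))
  rw [wirt_congr h1, dzbar_comp h2 (differentiableAt_chartChange he he' hz hz'),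
    θ.compFn_chartChange he he' hz hz' i]
  simp only [Finset.sum_mul, Finset.mul_sum]
  rw [Finset.sum_comm]
  refine Finset.sum_congr rfl fun _ _ => Finset.sum_congr rfl fun _ _ => ?_
  simp only [Function.comp_apply]
  ring

/-- The change of the Riemannian density. -/
lemma detComp_chartChange (h : HermitianMetric n M)
    (he : e ∈ atlas (Cn n) M) (he' : e' ∈ atlas (Cn n) M) (hz : z ∈ e.target)
    (hz' : e.symm z ∈ e'.source) :
    detComp (h.compFn e) z
      = (|(fderiv ℝ (e' ∘ e.symm) z).det| : ℝ) * detComp (h.compFn e') (e' (e.symm z)) := by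
  rw [detComp_eq_of_change fun i j => h.compFn_chartChange he he' hz hz' i j,
    abs_det_fderiv (differentiableAt_chartChange he he' hz hz')]

end ChartChange

/-! ### Integration on open subsets of `ℂⁿ`. -/

section Divergence

variable {n : ℕ} {U K : Set (Cn n)} {F : Cn n → ℂ}

local notation "μH" => (Measure.addHaar : Measure (Cn n))

/-- The integral of a derivative of a compactly supported function vanishes. -/
lemma setIntegral_wirt_eq_zero (hU : IsOpen U) (hK : IsCompact K) (hKU : K ⊆ U)
    (hF : ContDiffOn ℝ ∞ F U) (hF0 : ∀ z ∈ U, z ∉ K → F z = 0) (a : ℂ) (i : Fin n) :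
    ∫ z in U, wirt a i F z ∂μH = 0 := by
  classical
  -- Extension by zero is smooth on all of `ℂⁿ`, because `F` already vanishes on `U` outside the
  -- compact set `K`.
  set G : Cn n → ℂ := U.indicator F with hG
  have hGK : ∀ z ∉ K, G z = 0 := by
    intro z hz
    by_cases hzU : z ∈ U
    · rw [hG, Set.indicator_of_mem hzU, hF0 z hzU hz]
    · rw [hG, Set.indicator_of_notMem hzU]
  have hGF : ∀ z ∈ U, G =ᶠ[𝓝 z] F := fun z hz =>
    Filter.eventuallyEq_of_mem (hU.mem_nhds hz) fun w hw => Set.indicator_of_mem hw F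
  have hG0 : ∀ z ∉ K, G =ᶠ[𝓝 z] fun _ => 0 := fun z hz =>
    Filter.eventuallyEq_of_mem (hK.isClosed.isOpen_compl.mem_nhds hz) hGK
  have hsm : ContDiff ℝ ∞ G := by
    rw [contDiff_iff_contDiffAt]
    intro z
    by_cases hz : z ∈ U
    · exact (hF.contDiffAt (hU.mem_nhds hz)).congr_of_eventuallyEq (hGF z hz)
    · exact contDiffAt_const.congr_of_eventuallyEq (hG0 z fun h => hz (hKU h))
  have hc : HasCompactSupport G := HasCompactSupport.intro hK hGK
  have hint : ∀ v : Cn n, Integrable (fun z => fderiv ℝ G z v) μH := fun v =>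
    ((hsm.continuous_fderiv (by simp)).clm_apply continuous_const).integrable_of_hasCompactSupport
      (hc.fderiv_apply (𝕜 := ℝ) v)
  have hzero : ∀ v : Cn n, ∫ z, fderiv ℝ G z v ∂μH = 0 := by
    intro v
    -- Integration by parts against the constant function `1`.
    have h1 := integral_mul_fderiv_eq_neg_fderiv_mul_of_integrable (μ := μH) (𝕜 := ℂ)
      (f := fun _ : Cn n => (1 : ℂ)) (g := G) (v := v) (by simp) (by simpa using hint v)
      (by simpa using hsm.continuous.integrable_of_hasCompactSupport hc)
      (fun _ _ => differentiableAt_const _) (fun x _ => hsm.differentiable (by simp) x)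
    simpa using h1
  have h2 : ∫ z in U, wirt a i F z ∂μH = ∫ z, wirt a i G z ∂μH := by
    have e1 : ∫ z in U, wirt a i F z ∂μH = ∫ z in U, wirt a i G z ∂μH :=
      setIntegral_congr_fun hU.measurableSet fun z hz => (wirt_congr (hGF z hz)).symm
    rw [e1]
    refine setIntegral_eq_integral_of_forall_compl_eq_zero fun z hz => ?_
    rw [wirt_congr (hG0 z fun h => hz (hKU h)), wirt_const]
  rw [h2]
  simp only [wirt]
  rw [integral_div, integral_add (hint _) ((hint _).const_mul a), integral_const_mul, hzero, hzero]
  simp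

lemma integrableOn_of_compact (hU : IsOpen U) (hK : IsCompact K) (hKU : K ⊆ U)
    (hF : ContinuousOn F U) (hF0 : ∀ z ∈ U, z ∉ K → F z = 0) : IntegrableOn F U μH :=
  ((hF.mono hKU).integrableOn_compact hK).of_forall_sdiff_eq_zero hU.measurableSet
    fun z hz => hF0 z hz.1 hz.2

/-- A nonnegative continuous function with integral zero vanishes. -/
lemma eq_zero_of_setIntegral_eq_zero {f : Cn n → ℝ} (hU : IsOpen U) (hf : ContinuousOn f U)
    (hi : IntegrableOn f U μH) (h0 : ∀ z ∈ U, 0 ≤ f z) (hz : ∫ z in U, f z ∂μH = 0) :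
    ∀ z ∈ U, f z = 0 := by
  have h1 : f =ᵐ[(μH).restrict U] 0 :=
    (setIntegral_eq_zero_iff_of_nonneg_ae
      ((ae_restrict_iff' hU.measurableSet).2 (Filter.Eventually.of_forall h0)) hi).1 hz
  exact Measure.eqOn_open_of_ae_eq h1 hU hf continuousOn_const

end Divergence

/-! ### Chart integrals against the Riemannian density. -/

section ChartIntegral

variable {n : ℕ} {M : Type*} [TopologicalSpace M] [ChartedSpace (Cn n) M]
  {e e' : OpenPartialHomeomorph M (Cn n)} {z : Cn n}

/-- The integral over the domain of a chart for the Riemannian measure. -/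
def HermitianMetric.chartIntegral (h : HermitianMetric n M) (e : OpenPartialHomeomorph M (Cn n))
    (u : M → ℂ) : ℂ :=
  ∫ z in e.target, detComp (h.compFn e) z * u (e.symm z) ∂Measure.addHaar

/-- Both integrals reduce to the overlap of the charts, where the change of `det h` absorbs the
Jacobian in the change of variables. -/
lemma HermitianMetric.chartIntegral_eq [IsManifold 𝓘(ℂ, Cn n) ω M] (h : HermitianMetric n M)
    (he : e ∈ atlas (Cn n) M) (he' : e' ∈ atlas (Cn n) M) {u : M → ℂ}
    (hu : ∀ p ∉ e.source ∩ e'.source, u p = 0) : h.chartIntegral e u = h.chartIntegral e' u := by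
  have restr : ∀ {e e' : OpenPartialHomeomorph M (Cn n)},
      (∀ p ∉ e.source ∩ e'.source, u p = 0) → h.chartIntegral e u
        = ∫ z in (e.symm.trans e').source, detComp (h.compFn e) z * u (e.symm z)
          ∂Measure.addHaar := by
    intro e e' hu
    rw [HermitianMetric.chartIntegral]
    apply setIntegral_eq_of_subset_of_forall_sdiff_eq_zero e.open_target.measurableSet
    · intro z hz
      simp at hz
      exact hz.1
    · intro z hz
      rw [hu, mul_zero]
      intro h1
      exact hz.2 (mem_chartChange_source hz.1 h1.2)
  rw [restr hu, restr (e := e') (e' := e) fun p hp => hu p fun h1 => hp h1.symm]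
  have himg : (e'.symm.trans e).source = (e.symm.trans e') '' (e.symm.trans e').source := by
    rw [(e.symm.trans e').image_source_eq_target]
    simp
  have hd : ∀ z ∈ (e.symm.trans e').source, z ∈ e.target ∧ e.symm z ∈ e'.source := fun z hz => by
    simpa using hz
  rw [himg, integral_image_eq_integral_abs_det_fderiv_smul Measure.addHaar
    (e.symm.trans e').open_source.measurableSet (f' := fun z => fderiv ℝ (e' ∘ e.symm) z)
    (fun z hz => ?_) (e.symm.trans e').injOn]
  · refine setIntegral_congr_fun (e.symm.trans e').open_source.measurableSet fun z hz => ?_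
    have h1 := hd z hz
    simp only [OpenPartialHomeomorph.coe_trans, Function.comp_apply]
    rw [detComp_chartChange h he he' h1.1 h1.2, e'.left_inv h1.2, Complex.real_smul, mul_assoc]
  · have h1 := hd z hz
    exact ((differentiableAt_chartChange he he' h1.1 h1.2).restrictScalars
      ℝ).hasFDerivAt.hasFDerivWithinAt

end ChartIntegral

/-! ### Scalar functions on the manifold built from the Lee form. -/

section LeeScalars

variable {n : ℕ} {M : Type*} [TopologicalSpace M] [ChartedSpace (Cn n) M]
  {e : OpenPartialHomeomorph M (Cn n)} {z : Cn n}

/-- The function `h^{i j̄} θ_{i, j̄}`. -/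
def leeTrace (h : HermitianMetric n M) (θ : OneForm n M) (p : M) : ℂ :=
  trComp (h.compFn (chartAt (Cn n) p))
    (fun k l => ∂zb l (θ.compFn (chartAt (Cn n) p) k) (chartAt (Cn n) p p)) (chartAt (Cn n) p p)

/-- The function `h^{i j̄} θ_i θ_{j̄}`. -/
def leeNorm (h : HermitianMetric n M) (θ : OneForm n M) (p : M) : ℂ :=
  trComp (h.compFn (chartAt (Cn n) p))
    (fun k l => θ.compFn (chartAt (Cn n) p) k (chartAt (Cn n) p p)
      * conj (θ.compFn (chartAt (Cn n) p) l (chartAt (Cn n) p p))) (chartAt (Cn n) p p)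

/-- The function `h^{i j̄} θ_i ∂_{j̄} ψ`. -/
def leeDeriv (h : HermitianMetric n M) (θ : OneForm n M) (ψ : M → ℂ) (p : M) : ℂ :=
  trComp (h.compFn (chartAt (Cn n) p))
    (fun k l => θ.compFn (chartAt (Cn n) p) k (chartAt (Cn n) p p)
      * ∂zb l (ψ ∘ (chartAt (Cn n) p).symm) (chartAt (Cn n) p p)) (chartAt (Cn n) p p)

/-- Smoothness of a function on `M`, in terms of charts. -/
def IsSmoothFun (n : ℕ) {M V : Type*} [TopologicalSpace M] [ChartedSpace (Cn n) M]
    [NormedAddCommGroup V] [NormedSpace ℝ V] (ψ : M → V) : Prop :=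
  ∀ e ∈ atlas (Cn n) M, ContDiffOn ℝ ∞ (ψ ∘ e.symm) e.target

section

variable {h : HermitianMetric n M} {θ : OneForm n M}

lemma leeDeriv_sum {ι : Type*} {s : Finset ι} {φ : ι → M → ℂ} (hφ : ∀ i, IsSmoothFun n (φ i))
    (p : M) : leeDeriv h θ (fun q => ∑ i ∈ s, φ i q) p = ∑ i ∈ s, leeDeriv h θ (φ i) p := by
  have h1 : ∀ l, ∂zb l ((fun q => ∑ i ∈ s, φ i q) ∘ (chartAt (Cn n) p).symm) (chartAt (Cn n) p p)
      = ∑ i ∈ s, ∂zb l (φ i ∘ (chartAt (Cn n) p).symm) (chartAt (Cn n) p p) := fun l =>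
    wirt_sum (F := fun i => φ i ∘ (chartAt (Cn n) p).symm) fun i _ =>
      (((hφ i) _ (chart_mem_atlas _ p)).differentiableOn (by simp)).differentiableAt
        ((chartAt (Cn n) p).open_target.mem_nhds (mem_chart_target _ p))
  simp only [leeDeriv, trComp, h1, Finset.mul_sum]
  rw [Finset.sum_comm]
  conv_rhs => rw [Finset.sum_comm]
  rw [Finset.sum_comm]
  refine Finset.sum_congr rfl fun k _ => ?_
  rw [Finset.sum_comm]

lemma leeDeriv_eq_zero {ψ : M → ℂ} {p : M} {c : ℂ} (hψ : ψ =ᶠ[𝓝 p] fun _ => c) :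
    leeDeriv h θ ψ p = 0 := by
  have h1 : ψ ∘ (chartAt (Cn n) p).symm =ᶠ[𝓝 (chartAt (Cn n) p p)] fun _ => c := by
    have h2 : Filter.Tendsto (chartAt (Cn n) p).symm (𝓝 (chartAt (Cn n) p p)) (𝓝 p) := by
      have := (chartAt (Cn n) p).continuousAt_symm (mem_chart_target (Cn n) p)
      rwa [ContinuousAt, (chartAt (Cn n) p).left_inv (mem_chart_source _ p)] at this
    exact h2.eventually hψ
  simp only [leeDeriv, trComp]
  refine Finset.sum_eq_zero fun k _ => Finset.sum_eq_zero fun l _ => ?_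
  rw [wirt_congr h1, wirt_const, mul_zero, mul_zero]

lemma integrableOn_chart
    (hL : ∀ e ∈ atlas (Cn n) M, LeeData e.target (h.compFn e) (θ.compFn e))
    (he : e ∈ atlas (Cn n) M) {u : M → ℂ} (hu : IsSmoothFun n u) {K : Set M} (hK : IsCompact K)
    (hKe : K ⊆ e.source) (huK : ∀ p ∉ K, u p = 0) :
    IntegrableOn (fun z => detComp (h.compFn e) z * u (e.symm z)) e.target Measure.addHaar := by
  have hKt : e '' K ⊆ e.target := by
    rintro _ ⟨p, hp, rfl⟩
    exact e.map_source (hKe hp)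
  refine integrableOn_of_compact e.open_target
    (hK.image_of_continuousOn (e.continuousOn.mono hKe)) hKt
    ((contDiffOn_det (hL e he).smooth).mul (hu e he)).continuousOn fun z hz hzK => ?_
  rw [huK _ fun h2 => hzK ⟨_, h2, e.right_inv hz⟩, mul_zero]

lemma IsSmoothFun.mul {u v : M → ℂ} (hu : IsSmoothFun n u) (hv : IsSmoothFun n v) :
    IsSmoothFun n (fun p => u p * v p) := fun e he => (hu e he).mul (hv e he)

lemma IsSmoothFun.add {u v : M → ℂ} (hu : IsSmoothFun n u) (hv : IsSmoothFun n v) :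
    IsSmoothFun n (fun p => u p + v p) := fun e he => (hu e he).add (hv e he)

lemma IsSmoothFun.const (c : ℂ) : IsSmoothFun n (fun _ : M => c) := fun _ _ => contDiffOn_const

lemma IsSmoothFun.ofReal {u : M → ℝ} (hu : IsSmoothFun n u) :
    IsSmoothFun n (fun p => (u p : ℂ)) := fun e he =>
  Complex.ofRealCLM.contDiff.comp_contDiffOn (hu e he)

lemma IsSmoothFun.continuous {V : Type*} [NormedAddCommGroup V] [NormedSpace ℝ V] {u : M → V}
    (hu : IsSmoothFun n u) : Continuous u := by
  rw [continuous_iff_continuousAt]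
  intro p
  have h1 : ContinuousAt (u ∘ (chartAt (Cn n) p).symm) (chartAt (Cn n) p p) :=
    (hu _ (chart_mem_atlas _ p)).continuousOn.continuousAt
      ((chartAt (Cn n) p).open_target.mem_nhds (mem_chart_target _ p))
  have h2 := h1.comp ((chartAt (Cn n) p).continuousAt (mem_chart_source _ p))
  refine h2.congr ?_
  filter_upwards [(chartAt (Cn n) p).open_source.mem_nhds (mem_chart_source _ p)] with q hq
  simp [(chartAt (Cn n) p).left_inv hq]

end

variable [IsManifold 𝓘(ℂ, Cn n) ω M]

/-- The definition uses the preferred chart at each point; invariance under chart changes allows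
computing, and differentiating, in one fixed chart. The same holds for the next two lemmas. -/
lemma leeTrace_symm (h : HermitianMetric n M) {θ : OneForm n M} (hs : θ.IsSmooth)
    (he : e ∈ atlas (Cn n) M) (hz : z ∈ e.target) : leeTrace h θ (e.symm z)
      = trComp (h.compFn e) (fun k l => ∂zb l (θ.compFn e k) z) z :=
  (trComp_dzbar_lee_chartChange h hs he (chart_mem_atlas _ _) hz (mem_chart_source _ _)).symm

lemma leeNorm_symm (h : HermitianMetric n M) (θ : OneForm n M)
    (he : e ∈ atlas (Cn n) M) (hz : z ∈ e.target) : leeNorm h θ (e.symm z)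
      = trComp (h.compFn e) (fun k l => θ.compFn e k z * conj (θ.compFn e l z)) z :=
  (trComp_lee_chartChange h θ he (chart_mem_atlas _ _) hz (mem_chart_source _ _)).symm

lemma leeDeriv_symm (h : HermitianMetric n M) (θ : OneForm n M) {ψ : M → ℂ}
    (hψ : IsSmoothFun n ψ) (he : e ∈ atlas (Cn n) M) (hz : z ∈ e.target) :
    leeDeriv h θ ψ (e.symm z)
      = trComp (h.compFn e) (fun k l => θ.compFn e k z * ∂zb l (ψ ∘ e.symm) z) z :=
  (trComp_lee_fun_chartChange h θ (hψ _ (chart_mem_atlas _ _)) he (chart_mem_atlas _ _) hz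
    (mem_chart_source _ _)).symm

lemma contDiffOn_trComp {U : Set (Cn n)} {H : Fin n → Fin n → Cn n → ℂ} {t : Fin n → Cn n → ℂ}
    (L : LeeData U H t) {T : Fin n → Fin n → Cn n → ℂ} (hT : ∀ k l, ContDiffOn ℝ ∞ (T k l) U) :
    ContDiffOn ℝ ∞ (fun z => trComp H (fun k l => T k l z) z) U :=
  ContDiffOn.sum fun k _ => ContDiffOn.sum fun l _ => (L.smooth_inv l k).mul (hT k l)

end LeeScalars

/-! ### The divergence theorem on the compact manifold. -/

section Integration

variable {n : ℕ} {M : Type*} [TopologicalSpace M] [ChartedSpace (Cn n) M]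
  [IsManifold 𝓘(ℂ, Cn n) ω M] {h : HermitianMetric n M} {θ : OneForm n M}
  {e : OpenPartialHomeomorph M (Cn n)} {z : Cn n}

lemma isSmoothFun_leeTrace (hs : θ.IsSmooth)
    (hL : ∀ e ∈ atlas (Cn n) M, LeeData e.target (h.compFn e) (θ.compFn e)) :
    IsSmoothFun n (leeTrace h θ) := fun e he =>
  (contDiffOn_trComp (hL e he) fun k l =>
    contDiffOn_wirt (i := l) e.open_target ((hL e he).smooth_lee k)).congr
      fun _ hz => leeTrace_symm h hs he hz

lemma isSmoothFun_leeNorm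
    (hL : ∀ e ∈ atlas (Cn n) M, LeeData e.target (h.compFn e) (θ.compFn e)) :
    IsSmoothFun n (leeNorm h θ) := fun e he =>
  (contDiffOn_trComp (hL e he) fun k l => ((hL e he).smooth_lee k).mul
    (Complex.conjCLE.contDiff.comp_contDiffOn ((hL e he).smooth_lee l))).congr
      fun _ hz => leeNorm_symm h θ he hz

lemma isSmoothFun_leeDeriv {ψ : M → ℂ} (hψ : IsSmoothFun n ψ)
    (hL : ∀ e ∈ atlas (Cn n) M, LeeData e.target (h.compFn e) (θ.compFn e)) :
    IsSmoothFun n (leeDeriv h θ ψ) := fun e he =>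
  (contDiffOn_trComp (hL e he) fun k l => ((hL e he).smooth_lee k).mul
    (contDiffOn_wirt (i := l) e.open_target (hψ e he))).congr
      fun _ hz => leeDeriv_symm h θ hψ he hz

/-- The divergence theorem for `φ θ^♯`, where `φ` is supported in the domain of a chart. -/
lemma chartIntegral_div_eq_zero (hs : θ.IsSmooth)
    (hL : ∀ e ∈ atlas (Cn n) M, LeeData e.target (h.compFn e) (θ.compFn e))
    (he : e ∈ atlas (Cn n) M) {φ : M → ℂ} (hφ : IsSmoothFun n φ) {K : Set M} (hK : IsCompact K)
    (hKe : K ⊆ e.source) (hφK : ∀ p ∉ K, φ p = 0) :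
    h.chartIntegral e (fun p => φ p * (leeTrace h θ p + (n - 1) * leeNorm h θ p)
      + leeDeriv h θ φ p) = 0 := by
  have L := hL e he
  have h1 : h.chartIntegral e (fun p => φ p * (leeTrace h θ p + (n - 1) * leeNorm h θ p)
      + leeDeriv h θ φ p)
      = ∫ z in e.target, ∑ j, ∂zb j (fun w => (φ ∘ e.symm) w
        * ∑ i, detComp (h.compFn e) w * invComp (h.compFn e) j i w * θ.compFn e i w) z
        ∂Measure.addHaar := by
    refine setIntegral_congr_fun e.open_target.measurableSet fun z hz => ?_
    have hd : DifferentiableAt ℝ (φ ∘ e.symm) z :=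
      ((hφ e he).differentiableOn (by simp)).differentiableAt (e.open_target.mem_nhds hz)
    simp only
    rw [L.sum_dzbar_lee hz hd, leeTrace_symm h hs he hz, leeNorm_symm h θ he hz,
      leeDeriv_symm h θ hφ he hz]
    rfl
  have hK' : IsCompact (e '' K) := hK.image_of_continuousOn (e.continuousOn.mono hKe)
  have hKt : e '' K ⊆ e.target := by
    rintro _ ⟨p, hp, rfl⟩
    exact e.map_source (hKe hp)
  have hsm : ∀ j, ContDiffOn ℝ ∞ (fun w => (φ ∘ e.symm) w * ∑ i, detComp (h.compFn e) w
      * invComp (h.compFn e) j i w * θ.compFn e i w) e.target := fun j =>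
    (hφ e he).mul (ContDiffOn.sum fun i _ =>
      ((contDiffOn_det L.smooth).mul (L.smooth_inv j i)).mul (L.smooth_lee i))
  have h0 : ∀ z ∈ e.target, z ∉ e '' K → (φ ∘ e.symm) z = 0 := fun z hz hzK =>
    hφK _ fun h2 => hzK ⟨_, h2, e.right_inv hz⟩
  have h0' : ∀ j, ∀ z ∈ e.target, z ∉ e '' K → (fun w => (φ ∘ e.symm) w
      * ∑ i, detComp (h.compFn e) w * invComp (h.compFn e) j i w * θ.compFn e i w) z = 0 :=
    fun j z hz hzK => by simp only [h0 z hz hzK, zero_mul]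
  rw [h1, integral_finsetSum]
  · exact Finset.sum_eq_zero fun j _ =>
      setIntegral_wirt_eq_zero e.open_target hK' hKt (hsm j) (h0' j) _ _
  · intro j _
    refine integrableOn_of_compact e.open_target hK' hKt
      (contDiffOn_wirt e.open_target (hsm j)).continuousOn fun z hz hzK => ?_
    have h2 : (fun w => (φ ∘ e.symm) w * ∑ i, detComp (h.compFn e) w
        * invComp (h.compFn e) j i w * θ.compFn e i w) =ᶠ[𝓝 z] fun _ => 0 := by
      filter_upwards [e.open_target.mem_nhds hz, hK'.isClosed.isOpen_compl.mem_nhds hzK]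
        with w hw hwK using h0' j w hw hwK
    rw [wirt_congr h2, wirt_const]

lemma isSmoothFun_iff_contMDiff {u : M → ℝ} :
    IsSmoothFun n u ↔ ContMDiff 𝓘(ℝ, Cn n) 𝓘(ℝ, ℝ) ∞ u := by
  have : IsManifold 𝓘(ℝ, Cn n) ∞ M := isManifold_real
  constructor
  · intro hu p
    have h1 := ((contMDiffOn_iff_contDiffOn (𝕜 := ℝ)).2 (hu _ (chart_mem_atlas _ p))).comp
      (contMDiffOn_chart (I := 𝓘(ℝ, Cn n)) (n := ∞) (x := p))
      fun q hq => (chartAt (Cn n) p).map_source hq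
    refine (h1.contMDiffAt ((chartAt (Cn n) p).open_source.mem_nhds
      (mem_chart_source _ p))).congr_of_eventuallyEq ?_
    filter_upwards [(chartAt (Cn n) p).open_source.mem_nhds (mem_chart_source _ p)] with q hq
    simp [(chartAt (Cn n) p).left_inv hq]
  · intro hu e he
    rw [← contMDiffOn_iff_contDiffOn]
    exact hu.comp_contMDiffOn (contMDiffOn_symm_of_mem_maximalAtlas
      (IsManifold.subset_maximalAtlas he))

/-- If `tr θ_{i, j̄} + (n - 1) |θ|²` is nonnegative on an open and closed subset of the compact
manifold `M`, then it vanishes there. -/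
theorem lee_divergence_eq_zero [T2Space M] [CompactSpace M] (hs : θ.IsSmooth)
    (hL : ∀ e ∈ atlas (Cn n) M, LeeData e.target (h.compFn e) (θ.compFn e)) {Z : Set M}
    (hZ : IsClopen Z) (G : M → ℝ) (hG : ∀ p, leeTrace h θ p + (n - 1) * leeNorm h θ p = G p)
    (hpos : ∀ p ∈ Z, 0 ≤ G p) : ∀ p ∈ Z, G p = 0 := by
  classical
  have : IsManifold 𝓘(ℝ, Cn n) ∞ M := isManifold_real
  obtain ⟨s, hsc⟩ := isCompact_univ.elim_finite_subcover
    (fun p : M => (chartAt (Cn n) p).source) (fun p => (chartAt (Cn n) p).open_source)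
    fun p _ => Set.mem_iUnion.2 ⟨p, mem_chart_source _ p⟩
  obtain ⟨ρ, hρ⟩ := SmoothPartitionOfUnity.exists_isSubordinate (ι := s) 𝓘(ℝ, Cn n)
    (isClosed_univ (X := M)) (fun p : s => (chartAt (Cn n) (p : M)).source)
    (fun p => (chartAt (Cn n) (p : M)).open_source) (fun p hp => by
      obtain ⟨q, hq⟩ := Set.mem_iUnion.1 (hsc hp)
      obtain ⟨hqs, hq⟩ := Set.mem_iUnion.1 hq
      exact Set.mem_iUnion.2 ⟨⟨q, hqs⟩, hq⟩)
  set c : s → OpenPartialHomeomorph M (Cn n) := fun a => chartAt (Cn n) (a : M) with hc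
  have hca : ∀ a, c a ∈ atlas (Cn n) M := fun a => chart_mem_atlas _ _
  set r : s → M → ℂ := fun a p => ((ρ a p : ℝ) : ℂ) with hr
  have hrs : ∀ a, IsSmoothFun n (r a) := fun a =>
    IsSmoothFun.ofReal (isSmoothFun_iff_contMDiff.2 (ρ a).contMDiff)
  set K : s → Set M := fun a => tsupport (ρ a) with hKdef
  have hKc : ∀ a, IsCompact (K a) := fun a => (isClosed_tsupport _).isCompact
  have hKs : ∀ a, K a ⊆ (c a).source := fun a => hρ a
  have hr0 : ∀ a, ∀ p ∉ K a, r a p = 0 := fun a p hp => by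
    simp [hr, image_eq_zero_of_notMem_tsupport hp]
  have hr1 : ∀ p, ∑ a, r a p = 1 := by
    intro p
    have h1 := ρ.sum_eq_one (Set.mem_univ p)
    rw [finsum_eq_sum_of_fintype] at h1
    simp only [hr]
    exact_mod_cast h1
  -- Since `Z` is open and closed, its indicator is locally constant, so cutting off by it is smooth
  -- and produces no derivative terms.
  set χ : M → ℂ := Z.indicator fun _ => 1 with hχ
  have hχl : ∀ p, ∃ b : ℂ, χ =ᶠ[𝓝 p] fun _ => b := by
    intro p
    by_cases hp : p ∈ Z
    · exact ⟨1, Filter.eventuallyEq_of_mem (hZ.isOpen.mem_nhds hp) fun q hq =>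
        Set.indicator_of_mem hq _⟩
    · exact ⟨0, Filter.eventuallyEq_of_mem (hZ.isClosed.isOpen_compl.mem_nhds hp) fun q hq =>
        Set.indicator_of_notMem hq _⟩
  have hχs : IsSmoothFun n χ := by
    intro e he z hz
    obtain ⟨b, hb⟩ := hχl (e.symm z)
    have h1 : χ ∘ e.symm =ᶠ[𝓝 z] fun _ => b := (e.continuousAt_symm hz).eventually hb
    exact (contDiffAt_const.congr_of_eventuallyEq h1).contDiffWithinAt
  set φ : s → M → ℂ := fun a p => r a p * χ p with hφ
  have hφs : ∀ a, IsSmoothFun n (φ a) := fun a => (hrs a).mul hχs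
  have hφ0 : ∀ a, ∀ p ∉ K a, φ a p = 0 := fun a p hp => by simp [hφ, hr0 a p hp]
  -- `Q b` is the divergence of `φ b` times the Lee field, supported in one chart. As `∑ φ b = χ` is
  -- locally constant, the derivative terms cancel in the sum and `∑ Q b = χ G`.
  set Q : s → M → ℂ := fun b p =>
    φ b p * (leeTrace h θ p + (n - 1) * leeNorm h θ p) + leeDeriv h θ (φ b) p with hQ
  have hGs : IsSmoothFun n (fun p => leeTrace h θ p + (n - 1) * leeNorm h θ p) :=
    (isSmoothFun_leeTrace hs hL).add ((IsSmoothFun.const _).mul (isSmoothFun_leeNorm hL))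
  have hQs : ∀ b, IsSmoothFun n (Q b) := fun b =>
    ((hφs b).mul hGs).add (isSmoothFun_leeDeriv (hφs b) hL)
  have hQ0 : ∀ b, ∀ p ∉ K b, Q b p = 0 := by
    intro b p hp
    have h1 : φ b =ᶠ[𝓝 p] fun _ => 0 :=
      Filter.eventuallyEq_of_mem ((isClosed_tsupport _).isOpen_compl.mem_nhds hp) (hφ0 b)
    simp only [hQ, hφ0 b p hp, leeDeriv_eq_zero h1, zero_mul, add_zero]
  have hQsum : ∀ p, ∑ b, Q b p = χ p * G p := by
    intro p
    have h1 : ∀ q, ∑ b, φ b q = χ q := fun q => by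
      simp only [hφ, ← Finset.sum_mul, hr1, one_mul]
    have h2 : ∑ b, leeDeriv h θ (φ b) p = 0 := by
      rw [← leeDeriv_sum hφs, funext h1]
      exact leeDeriv_eq_zero (hχl p).choose_spec
    simp only [hQ, Finset.sum_add_distrib, ← Finset.sum_mul, h1, h2, hG, add_zero]
  have hInt : ∀ a b, IntegrableOn (fun z => detComp (h.compFn (c a)) z
      * (r a ((c a).symm z) * Q b ((c a).symm z))) (c a).target Measure.addHaar := fun a b =>
    integrableOn_chart hL (hca a) ((hrs a).mul (hQs b)) (hKc a) (hKs a)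
      fun p hp => by rw [hr0 a p hp, zero_mul]
  have hInt' : ∀ a b, IntegrableOn (fun z => detComp (h.compFn (c b)) z
      * (r a ((c b).symm z) * Q b ((c b).symm z))) (c b).target Measure.addHaar := fun a b =>
    integrableOn_chart hL (hca b) ((hrs a).mul (hQs b)) (hKc b) (hKs b)
      fun p hp => by rw [hQ0 b p hp, mul_zero]
  -- The product `r a * Q b` is supported in both charts, so its integral may be computed in either.
  have hswap : ∀ a b, h.chartIntegral (c a) (fun p => r a p * Q b p)
      = h.chartIntegral (c b) (fun p => r a p * Q b p) := by
    intro a b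
    refine h.chartIntegral_eq (hca a) (hca b) fun p hp => ?_
    by_cases hpa : p ∈ K a
    · have : p ∉ K b := fun hpb => hp ⟨hKs a hpa, hKs b hpb⟩
      rw [hQ0 b p this, mul_zero]
    · rw [hr0 a p hpa, zero_mul]
  -- The left side is the integral of `χ G` over `M`. Writing `χ G = ∑ Q b`, moving each `r a * Q b`
  -- to the chart `c b` and summing over `a` leaves the integrals of the divergences `Q b`.
  have htotal : ∑ a, h.chartIntegral (c a) (fun p => r a p * (χ p * G p)) = 0 := by
    have h1 : ∀ a, h.chartIntegral (c a) (fun p => r a p * (χ p * G p))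
        = ∑ b, h.chartIntegral (c b) (fun p => r a p * Q b p) := by
      intro a
      rw [Finset.sum_congr rfl fun b _ => (hswap a b).symm]
      simp only [HermitianMetric.chartIntegral]
      rw [← integral_finsetSum _ fun b _ => hInt a b]
      simp only [← Finset.mul_sum, hQsum]
    simp only [h1]
    rw [Finset.sum_comm]
    refine Finset.sum_eq_zero fun b _ => ?_
    have h2 := chartIntegral_div_eq_zero hs hL (hca b) (hφs b) (hKc b) (hKs b) (hφ0 b)
    rw [← h2]
    simp only [HermitianMetric.chartIntegral]
    rw [← integral_finsetSum _ fun a _ => hInt' a b]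
    simp only [← Finset.mul_sum, ← Finset.sum_mul, hr1, one_mul]
    rfl
  -- The integrands are real and nonnegative, so the vanishing of their total integral forces each
  -- of them to vanish.
  set f : s → Cn n → ℝ := fun a z => (detComp (h.compFn (c a)) z).re
    * (ρ a ((c a).symm z) * (Z.indicator (fun _ => 1) ((c a).symm z) * G ((c a).symm z))) with hf
  have hfeq : ∀ a, ∀ z ∈ (c a).target, detComp (h.compFn (c a)) z
      * (r a ((c a).symm z) * (χ ((c a).symm z) * G ((c a).symm z))) = (f a z : ℂ) := by
    intro a z hz
    have h1 : ((detComp (h.compFn (c a)) z).re : ℂ) = detComp (h.compFn (c a)) z := by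
      have h2 := (hL _ (hca a)).det_pos hz
      rw [Complex.lt_def] at h2
      exact Complex.ext (by simp) (by simpa using h2.2)
    have h3 : ((Z.indicator (fun _ => 1) ((c a).symm z) : ℝ) : ℂ) = χ ((c a).symm z) := by
      by_cases hq : (c a).symm z ∈ Z <;> simp [hχ, hq]
    simp only [hf, hr, Complex.ofReal_mul, h1, h3]
  have hfnonneg : ∀ a, ∀ z ∈ (c a).target, 0 ≤ f a z := by
    intro a z hz
    have h2 := (hL _ (hca a)).det_pos hz
    rw [Complex.lt_def] at h2
    refine mul_nonneg h2.1.le (mul_nonneg (ρ.nonneg a _) ?_)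
    by_cases hq : (c a).symm z ∈ Z
    · simpa [hq] using hpos _ hq
    · simp [hq]
  have hsmf : ∀ a, IsSmoothFun n (fun p => r a p * (χ p * (G p : ℂ))) := fun a => by
    have : IsSmoothFun n fun p => (G p : ℂ) := by simpa only [hG] using hGs
    exact (hrs a).mul (hχs.mul this)
  have hfint : ∀ a, IntegrableOn (f a) (c a).target Measure.addHaar := by
    intro a
    have h1 := integrableOn_chart hL (hca a) (hsmf a) (hKc a) (hKs a)
      fun p hp => by rw [hr0 a p hp, zero_mul]
    refine (integrableOn_congr_fun (fun z hz => ?_) (c a).open_target.measurableSet).1 h1.re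
    rw [hfeq a z hz]
    simp
  have hfcont : ∀ a, ContinuousOn (f a) (c a).target := by
    intro a
    have h1 : ContinuousOn (fun z => (detComp (h.compFn (c a)) z
        * (r a ((c a).symm z) * (χ ((c a).symm z) * G ((c a).symm z)))).re) (c a).target :=
      Complex.continuous_re.comp_continuousOn
        ((contDiffOn_det (hL _ (hca a)).smooth).mul (hsmf a _ (hca a))).continuousOn
    exact h1.congr fun z hz => (congrArg Complex.re (hfeq a z hz)).symm
  have hfsum : ∑ a, ∫ z in (c a).target, f a z ∂Measure.addHaar = 0 := by
    have h1 : ∀ a, h.chartIntegral (c a) (fun p => r a p * (χ p * G p))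
        = ((∫ z in (c a).target, f a z ∂Measure.addHaar : ℝ) : ℂ) := by
      intro a
      rw [HermitianMetric.chartIntegral, ← integral_complex_ofReal]
      exact setIntegral_congr_fun (c a).open_target.measurableSet fun z hz => hfeq a z hz
    simp only [h1] at htotal
    exact_mod_cast htotal
  have hfzero : ∀ a, ∀ z ∈ (c a).target, f a z = 0 := by
    intro a
    have h1 := (Finset.sum_eq_zero_iff_of_nonneg fun a _ =>
      setIntegral_nonneg (c a).open_target.measurableSet (hfnonneg a)).1 hfsum a (Finset.mem_univ a)
    exact eq_zero_of_setIntegral_eq_zero (c a).open_target (hfcont a) (hfint a) (hfnonneg a) h1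
  intro p hp
  have h1 : ∀ a, r a p * G p = 0 := by
    intro a
    by_cases hpa : p ∈ K a
    · have h2 := hfzero a (c a p) ((c a).map_source (hKs a hpa))
      have h3 := (hL _ (hca a)).det_pos ((c a).map_source (hKs a hpa))
      rw [Complex.lt_def] at h3
      simp only [hf, (c a).left_inv (hKs a hpa), Set.indicator_of_mem hp, one_mul] at h2
      have h4 := (mul_eq_zero.1 h2).resolve_left h3.1.ne'
      simp only [hr]
      exact_mod_cast h4
    · rw [hr0 a p hpa, zero_mul]
  have h2 : ∑ a, r a p * (G p : ℂ) = 0 := Finset.sum_eq_zero fun a _ => h1 a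
  rw [← Finset.sum_mul, hr1, one_mul] at h2
  exact_mod_cast h2

end Integration

/-! ### Conformal change of the metric. -/

section Conformal

variable {n : ℕ} {M : Type*} [TopologicalSpace M] [ChartedSpace (Cn n) M]
  {e : OpenPartialHomeomorph M (Cn n)} {z : Cn n}

/-- The metric `e^{-f} h`. -/
def HermitianMetric.conformal (h : HermitianMetric n M) {f : M → ℝ} (hf : IsSmoothFun n f) :
    HermitianMetric n M where
  form p := (Real.exp (-f p) : ℂ) • h.form p
  conj_symm p X Y := by
    change conj ((Real.exp (-f p) : ℂ) * h.form p X Y) = (Real.exp (-f p) : ℂ) * h.form p Y X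
    rw [map_mul, Complex.conj_ofReal, h.conj_symm]
  pos p X hX := by
    have h1 := mul_pos (Real.exp_pos (-f p)) (h.pos p X hX)
    simpa [Complex.exp_ofReal_re, ← Complex.ofReal_exp, ← Complex.ofReal_neg] using h1
  smooth e he i j := by
    have h1 : ContDiffOn ℝ ∞ (fun z => ((Real.exp (-f (e.symm z)) : ℝ) : ℂ)) e.target :=
      Complex.ofRealCLM.contDiff.comp_contDiffOn (hf e he).neg.exp
    exact h1.mul (h.smooth e he i j)

lemma HermitianMetric.conformal_form (h : HermitianMetric n M) {f : M → ℝ}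
    (hf : IsSmoothFun n f) (p : M) (X Y : Tan n p) :
    (h.conformal hf).form p X Y = (Real.exp (-f p) : ℂ) * h.form p X Y := rfl

lemma HermitianMetric.conformal_fundForm (h : HermitianMetric n M) {f : M → ℝ}
    (hf : IsSmoothFun n f) (v : Fin 2 → Cn n) :
    (h.conformal hf).fundForm e z v = Real.exp (-f (e.symm z)) * h.fundForm e z v := by
  change -2 * ((h.conformal hf).form (e.symm z) (coordMap e z (v 0)) (coordMap e z (v 1))).im
    = Real.exp (-f (e.symm z))
      * (-2 * (h.form (e.symm z) (coordMap e z (v 0)) (coordMap e z (v 1))).im)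
  rw [h.conformal_form, Complex.im_ofReal_mul]
  ring

/-- If the Lee form is exact, then the metric is globally conformal Kähler. -/
theorem HermitianMetric.isGloballyConformalKahler_of_exact [IsManifold 𝓘(ℂ, Cn n) ω M]
    (h : HermitianMetric n M) {θ : OneForm n M}
    (hd : ∀ e ∈ atlas (Cn n) M, ∀ z ∈ e.target, ∀ u v w : Cn n,
      extDeriv (h.fundForm e) z ![u, v, w] =
        θ.inChart e z u * h.fundForm e z ![v, w] - θ.inChart e z v * h.fundForm e z ![u, w]
          + θ.inChart e z w * h.fundForm e z ![u, v])
    {f : M → ℝ} (hf : IsSmoothFun n f)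
    (hfθ : ∀ e ∈ atlas (Cn n) M, ∀ z ∈ e.target, fderiv ℝ (f ∘ e.symm) z = θ.inChart e z) :
    h.IsGloballyConformalKahler := by
  refine ⟨f, h.conformal hf, isSmoothFun_iff_contMDiff.1 hf, ?_, fun p X Y => ?_⟩
  · intro e he z hz
    ext v
    have hv : v = ![v 0, v 1, v 2] := by
      ext i; fin_cases i <;> rfl
    have h1 := hd e he z hz (v 0) (v 1) (v 2)
    rw [extDeriv_two_apply (h.differentiableAt_fundForm he hz)] at h1
    rw [hv, extDeriv_two_apply ((h.conformal hf).differentiableAt_fundForm he hz)]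
    have hfd : DifferentiableAt ℝ (f ∘ e.symm) z :=
      ((hf e he).differentiableOn (by simp)).differentiableAt (e.open_target.mem_nhds hz)
    have hg := hfd.hasFDerivAt.neg.exp
    -- With `df = θ`, this is the term-by-term form of `d(e^{-f} ω) = e^{-f} (dω - θ ∧ ω)`.
    have key : ∀ (w : Fin 2 → Cn n) (u : Cn n),
        fderiv ℝ (fun x => (h.conformal hf).fundForm e x w) z u
          = Real.exp (-f (e.symm z)) * (fderiv ℝ (fun x => h.fundForm e x w) z u
            - θ.inChart e z u * h.fundForm e z w) := by
      intro w u
      have hΩ : DifferentiableAt ℝ (fun x => h.fundForm e x w) z :=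
        (h.differentiableAt_fundForm he hz).continuousAlternatingMap_apply
          (fun _ => differentiableAt_const _)
      have h2 := hg.mul hΩ.hasFDerivAt
      simp only [h.conformal_fundForm]
      refine (congrArg (fun L => L u) h2.fderiv).trans ?_
      simp [hfθ e he z hz]
      ring
    rw [key, key, key]
    change _ = (0 : ℝ)
    linear_combination Real.exp (-f (e.symm z)) * h1
  · rw [h.conformal_form, ← mul_assoc, ← Complex.ofReal_mul, ← Real.exp_add]
    simp

/-- In complex dimension at most one every Hermitian metric is Kähler. -/
lemma HermitianMetric.isKahler_of_le_one (h : HermitianMetric n M) (hn : n ≤ 1) : h.IsKahler := by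
  intro e _ z _
  ext v
  refine (extDeriv (h.fundForm e) z).toAlternatingMap.map_linearDependent v fun hv => ?_
  have h1 := hv.fintype_card_le_finrank
  have h2 : Module.finrank ℝ (Cn n) = 2 * n := by
    rw [← Module.finrank_mul_finrank ℝ ℂ (Cn n)]
    simp
  rw [h2, Fintype.card_fin] at h1
  omega

lemma HermitianMetric.isGloballyConformalKahler_of_isKahler {h : HermitianMetric n M}
    (hk : h.IsKahler) : h.IsGloballyConformalKahler :=
  ⟨fun _ => 0, h, contMDiff_const, hk, fun p X Y => by simp⟩

end Conformal

/-! ### The factor `λ` on the manifold and its zero set. -/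

section Factor

variable {n : ℕ} {M : Type*} [TopologicalSpace M] [ChartedSpace (Cn n) M]
  {h : HermitianMetric n M} {θ : OneForm n M}
  {e : OpenPartialHomeomorph M (Cn n)} {z : Cn n}

lemma HermitianMetric.chernCurv_eq (h : HermitianMetric n M)
    (e : OpenPartialHomeomorph M (Cn n)) (z : Cn n) (i j k l : Fin n) :
    h.chernCurv e z i j k l = curv (h.compFn e) i j k l z := by
  have h1 : ∀ p, h.christoffel e i k p = chris (h.compFn e) i k p := by
    intro p
    funext w
    simp only [HermitianMetric.christoffel, dz_eq_wirt]
    rfl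
  simp only [HermitianMetric.chernCurv, h1]
  rfl

lemma quartic_curv_eq {c : M → ℝ} (hH : h.HasPointwiseConstHolSecCurv c)
    (L : LeeData e.target (h.compFn e) (θ.compFn e)) (he : e ∈ atlas (Cn n) M)
    (hz : z ∈ e.target) (X : Fin n → ℂ) :
    quartic (fun i j k l => curv (h.compFn e) i j k l z) X X X X
      = c (e.symm z) * (∑ i, ∑ j, h.compFn e i j z * X i * conj (X j)) ^ 2 := by
  by_cases hX : X = 0
  · simp [hX, quartic]
  · have h1 := hH e he z hz (WithLp.toLp 2 X) fun h0 => hX ((WithLp.toLp_eq_zero 2).1 h0)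
    have h2 : (∑ i, ∑ j, h.compFn e i j z * X i * conj (X j)) ≠ 0 := fun h0 => by
      have := L.pos z hz X hX
      rw [h0] at this
      simp at this
    rw [HermitianMetric.holSecCurv] at h1
    have h3 := (div_eq_iff (pow_ne_zero 2 h2)).1 h1
    simp only [h.chernCurv_eq] at h3
    exact h3

/-- A real 1-form is twice the real part of its `(1,0)` part. -/
lemma eq_zero_of_compFn_eq_zero (h0 : ∀ i, θ.compFn e i z = 0) : θ.inChart e z = 0 := by
  ext u
  have h1 := θ.inChart_eq e z u
  simp only [h0, zero_mul, Finset.sum_const_zero] at h1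
  have h2 := congrArg Complex.re h1
  simpa using h2

lemma ofReal_re_leeTrace
    (hL : ∀ e ∈ atlas (Cn n) M, LeeData e.target (h.compFn e) (θ.compFn e)) (p : M) :
    ((leeTrace h θ p).re : ℂ) = leeTrace h θ p := by
  refine Complex.conj_eq_iff_re.1 ?_
  exact (hL _ (chart_mem_atlas _ p)).conj_trComp
    (fun i j => (hL _ (chart_mem_atlas _ p)).dzbar_lee _ (mem_chart_target _ p) i j) _

lemma ofReal_re_leeNorm
    (hL : ∀ e ∈ atlas (Cn n) M, LeeData e.target (h.compFn e) (θ.compFn e)) (p : M) :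
    ((leeNorm h θ p).re : ℂ) = leeNorm h θ p := by
  refine Complex.conj_eq_iff_re.1 ?_
  exact (hL _ (chart_mem_atlas _ p)).conj_trComp (fun i j => by simp [mul_comm]) _

/-- The function `λ` such that the Ricci form of the local Kähler metrics is `λ ω` plus a multiple
of the Hessian of the conformal factor. -/
def einsteinFactor (h : HermitianMetric n M) (θ : OneForm n M) (c : M → ℝ) (p : M) : ℝ :=
  (leeTrace h θ p).re / 4 + (n + 1) / 2 * c p

/-- A function with `dλ = -λ θ` vanishes on an open and closed set. -/
lemma isClopen_zeros (hs : θ.IsSmooth) {u : M → ℝ} (hu : IsSmoothFun n u)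
    (hud : ∀ e ∈ atlas (Cn n) M, ∀ z ∈ e.target,
      fderiv ℝ (u ∘ e.symm) z = -(u (e.symm z)) • θ.inChart e z) :
    IsClopen {p | u p = 0} := by
  refine ⟨isClosed_eq hu.continuous continuous_const, ?_⟩
  rw [isOpen_iff_mem_nhds]
  intro p hp
  set e := chartAt (Cn n) p with he
  have hea : e ∈ atlas (Cn n) M := chart_mem_atlas _ _
  obtain ⟨r, hr, hball⟩ := Metric.isOpen_iff.1 e.open_target (e p) (mem_chart_target _ p)
  -- On the segment from `e p` to `w`, which stays in the ball, `u` solves the linear equation `y' =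
  -- -θ(γ') y` with bounded coefficient and `y(0) = 0`; Grönwall's inequality gives `y = 0`.
  have hzero : ∀ w ∈ Metric.ball (e p) r, u (e.symm w) = 0 := by
    intro w hw
    set γ : ℝ → Cn n := fun s => e p + s • (w - e p) with hγ
    have hγd : ∀ s, HasDerivAt γ (w - e p) s := fun s => by
      have h1 := ((hasDerivAt_id s).smul_const (w - e p)).const_add (e p)
      rw [one_smul] at h1
      exact h1
    have hγm : ∀ s ∈ Set.Icc (0 : ℝ) 1, γ s ∈ e.target := by
      intro s hs'
      refine hball ((convex_ball (e p) r).add_smul_sub_mem (Metric.mem_ball_self hr) hw hs')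
    have hγc : Continuous γ := continuous_iff_continuousAt.2 fun s => (hγd s).continuousAt
    have hcont : ContinuousOn (fun s => θ.inChart e (γ s) (w - e p)) (Set.Icc 0 1) :=
      ((hs e hea).continuousOn.comp hγc.continuousOn hγm).clm_apply continuousOn_const
    obtain ⟨C, hC⟩ := isCompact_Icc.exists_bound_of_continuousOn hcont
    have hderiv : ∀ s ∈ Set.Icc (0 : ℝ) 1, HasDerivAt (fun s => u (e.symm (γ s)))
        (-(u (e.symm (γ s))) * θ.inChart e (γ s) (w - e p)) s := by
      intro s hs'
      have hd : DifferentiableAt ℝ (u ∘ e.symm) (γ s) :=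
        ((hu e hea).differentiableOn (by simp)).differentiableAt
          (e.open_target.mem_nhds (hγm s hs'))
      have h1 := hd.hasFDerivAt.comp_hasDerivAt s (hγd s)
      rw [hud e hea _ (hγm s hs')] at h1
      exact h1
    have h0 : u (e.symm (γ 0)) = 0 := by
      simp only [hγ, zero_smul, add_zero]
      rw [e.left_inv (mem_chart_source _ p)]
      exact hp
    have h1 := eq_zero_of_abs_deriv_le_mul_abs_self_of_eq_zero_right
      (f := fun s => u (e.symm (γ s))) (K := C)
      (fun s hs' => (hderiv s hs').continuousAt.continuousWithinAt)
      (fun s hs' => (hderiv s (Set.Ico_subset_Icc_self hs')).hasDerivWithinAt) h0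
      (fun s hs' => by
        rw [norm_mul, norm_neg, mul_comm]
        exact mul_le_mul_of_nonneg_right (hC s (Set.Ico_subset_Icc_self hs')) (norm_nonneg _))
      1 (by simp)
    simpa [hγ] using h1
  filter_upwards [e.open_source.mem_nhds (mem_chart_source _ p),
    (e.continuousAt (mem_chart_source _ p)).preimage_mem_nhds (Metric.ball_mem_nhds (e p) hr)]
    with q hq hqb
  have := hzero (e q) hqb
  rwa [e.left_inv hq] at this

variable [IsManifold 𝓘(ℂ, Cn n) ω M]

lemma einsteinFactor_symm (hs : θ.IsSmooth)
    (hL : ∀ e ∈ atlas (Cn n) M, LeeData e.target (h.compFn e) (θ.compFn e)) (c : M → ℝ)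
    (he : e ∈ atlas (Cn n) M) (hz : z ∈ e.target) :
    ((einsteinFactor h θ c (e.symm z) : ℝ) : ℂ)
      = trComp (h.compFn e) (fun k l => ∂zb l (θ.compFn e k) z) z / 4
        + (n + 1) / 2 * (c (e.symm z) : ℂ) := by
  rw [← leeTrace_symm h hs he hz, ← ofReal_re_leeTrace hL, einsteinFactor]
  push_cast
  ring

/-- Only the combination of `c` with the trace of `θ_{i,j̄}` is known to be smooth a priori in the
second summand's place: the traced curvature identity exhibits it as a trace of smooth functions. -/
lemma isSmoothFun_einsteinFactor (hn : 2 ≤ n) (hs : θ.IsSmooth)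
    (hL : ∀ e ∈ atlas (Cn n) M, LeeData e.target (h.compFn e) (θ.compFn e)) {c : M → ℝ}
    (hH : h.HasPointwiseConstHolSecCurv c) : IsSmoothFun n (einsteinFactor h θ c) := by
  intro e he
  have h1 := ((hL e he).einstein_factor hn (c := fun z => c (e.symm z))
    fun z hz X => quartic_curv_eq hH (hL e he) he hz X).1
  refine (Complex.reCLM.contDiff.comp_contDiffOn h1).congr fun z hz => ?_
  simp only [Function.comp_apply, ← einsteinFactor_symm hs hL c he hz]
  simp

/-- `dλ = -λ θ`. -/
lemma fderiv_einsteinFactor (hn : 2 ≤ n) (hs : θ.IsSmooth)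
    (hL : ∀ e ∈ atlas (Cn n) M, LeeData e.target (h.compFn e) (θ.compFn e)) {c : M → ℝ}
    (hH : h.HasPointwiseConstHolSecCurv c) (he : e ∈ atlas (Cn n) M) (hz : z ∈ e.target) :
    fderiv ℝ (einsteinFactor h θ c ∘ e.symm) z
      = -(einsteinFactor h θ c (e.symm z)) • θ.inChart e z := by
  have hd : DifferentiableAt ℝ (einsteinFactor h θ c ∘ e.symm) z :=
    ((isSmoothFun_einsteinFactor hn hs hL hH e he).differentiableOn (by simp)).differentiableAt
      (e.open_target.mem_nhds hz)
  have h1 := ((hL e he).einstein_factor hn (c := fun z => c (e.symm z))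
    fun z hz X => quartic_curv_eq hH (hL e he) he hz X).2 z hz
  rw [← einsteinFactor_symm hs hL c he hz] at h1
  have h2 : ∀ v, fderiv ℝ (fun w => ((einsteinFactor h θ c (e.symm w) : ℝ) : ℂ)) z v
      = (fderiv ℝ (einsteinFactor h θ c ∘ e.symm) z v : ℝ) := fun v =>
    congrArg (fun L => L v) (Complex.ofRealCLM.hasFDerivAt.comp z hd.hasFDerivAt).fderiv
  have h3 : ∀ m, fderiv ℝ (einsteinFactor h θ c ∘ e.symm) z (EuclideanSpace.single m 1)
        = -(einsteinFactor h θ c (e.symm z)) * θ.inChart e z (EuclideanSpace.single m 1) ∧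
      fderiv ℝ (einsteinFactor h θ c ∘ e.symm) z (EuclideanSpace.single m Complex.I)
        = -(einsteinFactor h θ c (e.symm z))
          * θ.inChart e z (EuclideanSpace.single m Complex.I) := by
    intro m
    have e1 := h1 m
    rw [(hL e he).wirt_eq hz fun w hw => (einsteinFactor_symm hs hL c he hw).symm, wirt, h2, h2,
      OneForm.compFn] at e1
    have e2 := congrArg Complex.re e1
    have e3 := congrArg Complex.im e1
    simp at e2 e3
    constructor <;> linarith
  ext v
  have h4 := real_linear_apply (fderiv ℝ (einsteinFactor h θ c ∘ e.symm) z).toLinearMap v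
  have h5 := real_linear_apply (θ.inChart e z).toLinearMap v
  simp only [ContinuousLinearMap.coe_coe] at h4 h5
  rw [h4, smul_apply, h5, Finset.smul_sum]
  refine Finset.sum_congr rfl fun m _ => ?_
  rw [(h3 m).1, (h3 m).2]
  simp only [smul_eq_mul]
  ring

/-- On the set where `λ` vanishes, the Lee form vanishes. -/
lemma inChart_eq_zero_of_einsteinFactor_eq_zero [T2Space M] [CompactSpace M] (hn : 2 ≤ n)
    (hs : θ.IsSmooth)
    (hL : ∀ e ∈ atlas (Cn n) M, LeeData e.target (h.compFn e) (θ.compFn e)) {c : M → ℝ}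
    (hc : ∀ p, c p ≤ 0) (hZ : IsClopen {p | einsteinFactor h θ c p = 0})
    (he : e ∈ atlas (Cn n) M) (hz : z ∈ e.target) (h0 : einsteinFactor h θ c (e.symm z) = 0) :
    θ.inChart e z = 0 := by
  have hn1 : (1 : ℝ) ≤ (n : ℝ) - 1 := by
    have : (2 : ℝ) ≤ n := by exact_mod_cast hn
    linarith
  have hnorm : ∀ p, 0 ≤ (leeNorm h θ p).re := fun p =>
    (hL _ (chart_mem_atlas _ p)).trComp_lee_nonneg (mem_chart_target _ p) _
  -- Where `λ = 0`, the trace equals `-2(n+1) c`; this is where the sign of `c` enters.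
  have htrace : ∀ p, einsteinFactor h θ c p = 0 → 0 ≤ (leeTrace h θ p).re := by
    intro p hp
    rw [einsteinFactor] at hp
    have h1 : 0 ≤ ((n : ℝ) + 1) / 2 * (-c p) :=
      mul_nonneg (by positivity) (neg_nonneg.2 (hc p))
    linarith
  have h1 := lee_divergence_eq_zero hs hL hZ
    (fun p => (leeTrace h θ p).re + ((n : ℝ) - 1) * (leeNorm h θ p).re)
    (fun p => by
      push_cast
      rw [ofReal_re_leeTrace hL, ofReal_re_leeNorm hL])
    (fun p hp => add_nonneg (htrace p hp) (mul_nonneg (by linarith) (hnorm p)))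
    (e.symm z) h0
  -- Both summands of the vanishing function are nonnegative and `n - 1 ≥ 1`.
  have h2 : (leeNorm h θ (e.symm z)).re = 0 := by
    have h3 := htrace _ h0
    have h4 := hnorm (e.symm z)
    nlinarith
  refine eq_zero_of_compFn_eq_zero ?_
  by_contra hne
  have h3 : (fun i => θ.compFn e i z) ≠ 0 := fun h4 => hne fun i => congrFun h4 i
  have h4 := (hL e he).trComp_lee_pos hz h3
  rw [← leeNorm_symm h θ he hz, h2] at h4
  exact lt_irrefl _ h4

end Factor

end LCK

end

/-! ### The main theorem. -/

open LCK in
theorem theorem1p2 {n : ℕ} {M : Type*} [TopologicalSpace M] [T2Space M] [CompactSpace M]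
    [ChartedSpace (LCK.Cn n) M] [IsManifold 𝓘(ℂ, LCK.Cn n) ω M]
    (h : LCK.HermitianMetric n M) (hlck : h.IsLocallyConformalKahler)
    (c : M → ℝ) (hc : ∀ p, c p ≤ 0) (hH : h.HasPointwiseConstHolSecCurv c) :
    h.IsGloballyConformalKahler := by
  rcases Nat.lt_or_ge 1 n with hn | hn
  swap
  · exact HermitianMetric.isGloballyConformalKahler_of_isKahler (h.isKahler_of_le_one hn)
  obtain ⟨θ, hs, hcl, hd⟩ := hlck
  have hL : ∀ e ∈ atlas (Cn n) M, LeeData e.target (h.compFn e) (θ.compFn e) := fun e he =>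
    h.leeData hs hcl hd he
  have hsm := isSmoothFun_einsteinFactor hn hs hL hH
  have hder := fun e he z hz => fderiv_einsteinFactor (e := e) (z := z) hn hs hL hH he hz
  have hZ := isClopen_zeros hs hsm hder
  -- `Real.log x` is `log |x|` and `Real.log 0 = 0`, so `-log λ` is a single formula for the
  -- primitive: it covers both signs of `λ` and vanishes on the zero set, which is open.
  have key : ∀ e ∈ atlas (Cn n) M, ∀ z ∈ e.target,
      ContDiffAt ℝ ∞ ((fun p => -Real.log (einsteinFactor h θ c p)) ∘ e.symm) z ∧
      fderiv ℝ ((fun p => -Real.log (einsteinFactor h θ c p)) ∘ e.symm) z = θ.inChart e z := by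
    intro e he z hz
    by_cases h0 : einsteinFactor h θ c (e.symm z) = 0
    · have h1 : (fun p => -Real.log (einsteinFactor h θ c p)) ∘ e.symm =ᶠ[nhds z] fun _ => 0 := by
        filter_upwards [(e.continuousAt_symm hz).preimage_mem_nhds (hZ.isOpen.mem_nhds h0)]
          with w hw
        have hw : einsteinFactor h θ c (e.symm w) = 0 := hw
        simp [hw]
      refine ⟨contDiffAt_const.congr_of_eventuallyEq h1, ?_⟩
      rw [h1.fderiv_eq, inChart_eq_zero_of_einsteinFactor_eq_zero hn hs hL hc hZ he hz h0]
      simp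
    · have h1 : ContDiffAt ℝ ∞ (einsteinFactor h θ c ∘ e.symm) z :=
        (hsm e he).contDiffAt (e.open_target.mem_nhds hz)
      have h2 := ((h1.differentiableAt (by simp)).hasFDerivAt.log h0).neg
      refine ⟨(h1.log h0).neg, h2.fderiv.trans ?_⟩
      rw [hder e he z hz]
      ext v
      simp only [Function.comp_apply, neg_apply, smul_apply, smul_eq_mul]
      field_simp
  exact h.isGloballyConformalKahler_of_exact hd
    (fun e he z hz => (key e he z hz).1.contDiffWithinAt) fun e he z hz => (key e he z hz).2
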